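/- **Setting.** Consider $f^*=\min\{f(u): u\in U,\ Gu+g=0\}$, where $f:\mathbb{R}^n\to\mathbb{R}$ is convex with $L_f$-Lipschitz gradient on $\mathbb{R}^n$ ($L_f>0$), $U\subseteq\mathbb{R}^n$ is nonempty, closed, convex and bounded with diameter $D_U$, $G\in\mathbb{R}^{m\times n}$ with spectral norm $\|G\|$, and $g\in\mathbb{R}^m$. Assume that an optimal solution exists. Let $d(x)=\min_{u\in U}\{f(u)+\langle x,Gu+g\rangle\}$ and let $x^*$ be an optimal Lagrange multiplier, i.e. $d(x^*)=\max d=f^*$; assume $\|x^*\|\ge 2$. For $\epsilon>0$, a point $u\in U$ is $\epsilon$-optimal if $f(u)-f^*\le\epsilon$ and $\|Gu+g\|\le\epsilon$. For $\rho,\mu>0$ put $\mathcal L_\rho(u,x)=f(u)+\langle x,Gu+g\rangle+\frac\rho2\|Gu+g\|^2$, $d_\rho(x)=\min_{u\in U}\mathcal L_\rho(u,x)$ and $f_\mu(u)=\max_x\{f(u)+\langle x,Gu+g\rangle-\frac\mu2\|x\|^2\}=f(u)+\frac1{2\mu}\|Gu+g\|^2$. **Algorithm IFAL$(\rho,\epsilon)$.**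 Let $\mu_0=\frac4\rho$, $\tau_k=\frac2{k+3}$, $\delta_k=\frac{\epsilon}{2(k+3)}$. Given $(u^0,x^0)$, for $k=0,1,\dots$: set $\hat x^k=(1-\tau_k)x^k+\frac{\tau_k}{\mu_k}(Gu^k+g)$; compute an approximate minimizer $\tilde u^k\in U$ of $\mathcal L_\rho(\cdot,\hat x^k)$ over $U$; set $u^{k+1}=(1-\tau_k)u^k+\tau_k\tilde u^k$, $x^{k+1}=\hat x^k+\rho(G\tilde u^k+g)$, $\mu_{k+1}=(1-\tau_k)\mu_k$. The inner call $k$ is *accurate* if $\mathcal L_\rho(\tilde u^k,\hat x^k)-d_\rho(\hat x^k)\le\delta_k$. The initial pair satisfies $u^0\in U$ and either $f_{\mu_0}(u^0)-d_\rho(x^0)\le\delta_0$, or $\mathcal L_\rho(u^0,0)-d_\rho(0)\le\delta_0$ and $x^0=\frac1{\mu_0}(Gu^0+g)$; the cost of producing it is not counted. The inner calls use Nesterov's optimal method for $\Phi=\mathcal L_\rho(\cdot,\hat x^k)$ with $L=L_f+\rho\|G\|^2$: from $z_0=y_0=v\in U$ and $t_0=1$, iterate $z_{j+1}=\mathrm{proj}_U(y_j-\frac1L\nabla\Phi(y_j))$,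 $t_{j+1}=\frac{1+\sqrt{1+4t_j^2}}2$, $y_{j+1}=z_{j+1}+\frac{t_j-1}{t_{j+1}}(z_{j+1}-z_j)$. Thus $N$ inner iterations cost $N$ projections onto $U$ and return $\tilde u^k=z_N$. The starting point $v\in U$ of each call is arbitrary. **Theorem.** Let $\epsilon>0$ and $$B(\epsilon)=\sqrt{\frac{6L_fD_U^2}{\epsilon}}+\frac{4\sqrt6\,D_U\|G\|\|x^*\|}{\epsilon},\qquad \rho_0=\frac{16\|x^*\|^2}{\epsilon}.$$ 1. *(Single outer iteration.)* Run IFAL$(\rho_0,\epsilon)$. If its first inner call is accurate, then $u^1$ is $\epsilon$-optimal. 2. *(Number of projections.)* For IFAL$(\rho_0,\epsilon)$, with every starting point of the inner method: (a) if the first inner call runs for at least $\max\{1,\lfloor B(\epsilon)\rfloor\}$ iterations, then $u^1$ is $\epsilon$-optimal; so an $\epsilon$-optimal solution is obtained with at most $\max\{1,\lfloor B(\epsilon)\rfloor\}$ projections onto $U$; (b) the first inner call is accurate after every number of iterations that is at least $\max\{1,\lfloor 2B(\epsilon)\rfloor\}$, and at least $\max\{1,\lfloor B(\epsilon)\rfloor\}$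 suffices if the starting point $v$ satisfies $\|v-u\|\le D_U/\sqrt2$ for all $u\in U$. Hence, if the inner method is stopped at its first iterate of accuracy $\delta_0$, the number of projections in the single outer iteration is at most these values. Points $v\in U$ with this property exist. In particular, for a fixed problem, $\max\{1,\lfloor 2B(\epsilon)\rfloor\}=O(1/\epsilon)$ as $\epsilon\to0^+$. 3. *(Complexity estimate for arbitrary $\rho$, and optimality of $\rho_0$ up to a constant factor.)* For $\rho>0$ let $N(\rho)=1$ if $\rho\ge\rho_0$, $N(\rho)=\lceil 2^{5/2}\|x^*\|/\sqrt{\rho\epsilon}\,\rceil$ if $\rho<\rho_0$, and $$N_k(\rho)=\max\Big\{1,\Big\lfloor 2D_U\sqrt{\tfrac{L_f+\rho\|G\|^2}{\delta_k}}\Big\rfloor\Big\},\qquad T(\rho)=\sum_{k=0}^{N(\rho)-1}N_k(\rho).$$ For every $\rho>0$, in IFAL$(\rho,\epsilon)$ the $k$-th inner call is accurate after every number of iterations that is at least $N_k(\rho)$; if the calls $k<N(\rho)$ are accurate, then $u^{N(\rho)}$ is $\epsilon$-optimal; and if each of these calls is stopped at its first iterate of accuracy $\delta_k$, at most $T(\rho)$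 projections are used in total. The choice $\rho_0$ minimizes this complexity estimate up to a constant factor: $T(\rho_0)\le 2\,T(\rho)$ for all $\rho>0$. -/

import Mathlib

noncomputable section

/-- Data of the problem `min f(u)` subject to `u ∈ U`, `G u + g = 0`. An `m × n` matrix `G` is
given as the corresponding linear map between Euclidean spaces; its operator norm is the spectral
norm. -/
structure LinProblem (n m : ℕ) where
  f : EuclideanSpace ℝ (Fin n) → ℝ
  U : Set (EuclideanSpace ℝ (Fin n))
  G : EuclideanSpace ℝ (Fin n) →L[ℝ] EuclideanSpace ℝ (Fin m)
  g : EuclideanSpace ℝ (Fin m)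

/-- A metric projection of `y` onto `U`: a point of `U` nearest to `y` (there is exactly one when
`U` is nonempty, closed and convex). -/
def metricProj {n : ℕ} (U : Set (EuclideanSpace ℝ (Fin n))) (y : EuclideanSpace ℝ (Fin n)) :
    EuclideanSpace ℝ (Fin n) :=
  Classical.epsilon fun p => p ∈ U ∧ ∀ u ∈ U, ‖y - p‖ ≤ ‖y - u‖

theorem metricProj_spec {n : ℕ} {U : Set (EuclideanSpace ℝ (Fin n))} (hne : U.Nonempty)
    (hcl : IsClosed U) (y : EuclideanSpace ℝ (Fin n)) :
    metricProj U y ∈ U ∧ ∀ u ∈ U, ‖y - metricProj U y‖ ≤ ‖y - u‖ := by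
  have h : ∃ p, p ∈ U ∧ ∀ u ∈ U, ‖y - p‖ ≤ ‖y - u‖ := by
    obtain ⟨p, hp, hpe⟩ := hcl.exists_infDist_eq_dist hne y
    refine ⟨p, hp, fun u hu => ?_⟩
    rw [← dist_eq_norm, ← dist_eq_norm, ← hpe]
    exact Metric.infDist_le_dist_of_mem hu
  exact Classical.epsilon_spec h

/-- State of Nesterov's method: current point, extrapolated point, the scalar `t`, and the number
of projections performed so far. -/
structure NesterovState (n : ℕ) where
  point : EuclideanSpace ℝ (Fin n)
  extrap : EuclideanSpace ℝ (Fin n)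
  t : ℝ
  projections : ℕ

/-- One iteration of Nesterov's optimal method for minimizing `Φ` (with `L`-Lipschitz gradient)
over the simple set `U`: a gradient step from the extrapolated point, one projection onto `U`,
extrapolation. With `α = 1 / t` this is `α₊² = (1 - α₊) α²`, `β = α (1 - α) / (α² + α₊)`. -/
def nesterovStep {n : ℕ} (Φ : EuclideanSpace ℝ (Fin n) → ℝ) (L : ℝ)
    (U : Set (EuclideanSpace ℝ (Fin n))) (s : NesterovState n) : NesterovState n :=
  let p := metricProj U (s.extrap - (1 / L) • gradient Φ s.extrap)
  let t' := (1 + √(1 + 4 * s.t ^ 2)) / 2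
  { point := p
    extrap := p + ((s.t - 1) / t') • (p - s.point)
    t := t'
    projections := s.projections + 1 }

/-- The state of Nesterov's method started at `v` after `N` iterations. -/
def nesterov {n : ℕ} (Φ : EuclideanSpace ℝ (Fin n) → ℝ) (L : ℝ)
    (U : Set (EuclideanSpace ℝ (Fin n))) (v : EuclideanSpace ℝ (Fin n)) (N : ℕ) :
    NesterovState n :=
  (nesterovStep Φ L U)^[N] { point := v, extrap := v, t := 1, projections := 0 }

/-- Outer state `(uᵏ, xᵏ)`, the parameter `μ_k`, and the number of projections performed so
far. -/
structure IFALState (n m : ℕ) where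
  u : EuclideanSpace ℝ (Fin n)
  x : EuclideanSpace ℝ (Fin m)
  mu : ℝ
  projections : ℕ

/-- `τ_k = 2 / (k + 3)`. -/
def ifalTau (k : ℕ) : ℝ := 2 / ((k : ℝ) + 3)

/-- The inner accuracy `δ_k = ε / (2 (k + 3))`. -/
def ifalDelta (ε : ℝ) (k : ℕ) : ℝ := ε / (2 * ((k : ℝ) + 3))

namespace LinProblem

variable {n m : ℕ} (P : LinProblem n m)

def feasible : Set (EuclideanSpace ℝ (Fin n)) := {u | u ∈ P.U ∧ P.G u + P.g = 0}

/-- The optimal solution set `U*`. -/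
def solutions : Set (EuclideanSpace ℝ (Fin n)) :=
  {u | u ∈ P.feasible ∧ ∀ v ∈ P.feasible, P.f u ≤ P.f v}

/-- The optimal value `f*`. -/
def optVal : ℝ := sInf (P.f '' P.feasible)

/-- `u` is an `ε`-optimal solution. -/
def IsEpsOptimal (ε : ℝ) (u : EuclideanSpace ℝ (Fin n)) : Prop :=
  u ∈ P.U ∧ P.f u - P.optVal ≤ ε ∧ ‖P.G u + P.g‖ ≤ ε

/-- The standing assumptions: `f` is convex with `Lf`-Lipschitz gradient on the whole space,
`Lf > 0`; `U` is nonempty, closed, convex, bounded; an optimal solution exists. -/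
structure Standing (Lf : ℝ) : Prop where
  convex_f : ConvexOn ℝ Set.univ P.f
  differentiable_f : Differentiable ℝ P.f
  Lf_pos : 0 < Lf
  lipschitz_gradient : ∀ u v, ‖gradient P.f u - gradient P.f v‖ ≤ Lf * ‖u - v‖
  nonempty_U : P.U.Nonempty
  closed_U : IsClosed P.U
  convex_U : Convex ℝ P.U
  bounded_U : Bornology.IsBounded P.U
  nonempty_solutions : P.solutions.Nonempty

/-- The Lagrangian `f(u) + ⟨x, G u + g⟩`. -/
def lagrangian (u : EuclideanSpace ℝ (Fin n)) (x : EuclideanSpace ℝ (Fin m)) : ℝ :=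
  P.f u + inner ℝ x (P.G u + P.g)

/-- The dual function `d(x) = min_{u ∈ U} (f(u) + ⟨x, G u + g⟩)`. -/
def dual (x : EuclideanSpace ℝ (Fin m)) : ℝ := sInf ((fun u => P.lagrangian u x) '' P.U)

/-- `x` is an optimal Lagrange multiplier: it maximizes the dual function, with value `f*`. -/
def IsOptimalMultiplier (x : EuclideanSpace ℝ (Fin m)) : Prop :=
  P.dual x = P.optVal ∧ ∀ y, P.dual y ≤ P.dual x

/-- The augmented Lagrangian `f(u) + ⟨x, G u + g⟩ + (ρ/2) ‖G u + g‖²`. -/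
def augLag (ρ : ℝ) (u : EuclideanSpace ℝ (Fin n)) (x : EuclideanSpace ℝ (Fin m)) : ℝ :=
  P.f u + inner ℝ x (P.G u + P.g) + ρ / 2 * ‖P.G u + P.g‖ ^ 2

/-- The smoothed dual function `d_ρ(x)`: the minimum over `u ∈ U` of the augmented Lagrangian. -/
def augDual (ρ : ℝ) (x : EuclideanSpace ℝ (Fin m)) : ℝ :=
  sInf ((fun u => P.augLag ρ u x) '' P.U)

/-- The smoothed primal function
`f_μ(u) = max_x (f(u) + ⟨x, G u + g⟩ - (μ/2) ‖x‖²)`, in closed form. -/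
def smoothedPrimal (μ : ℝ) (u : EuclideanSpace ℝ (Fin n)) : ℝ :=
  P.f u + 1 / (2 * μ) * ‖P.G u + P.g‖ ^ 2

theorem smoothedPrimal_isGreatest {μ : ℝ} (hμ : 0 < μ) (u : EuclideanSpace ℝ (Fin n)) :
    IsGreatest (Set.range fun x => P.lagrangian u x - μ / 2 * ‖x‖ ^ 2)
      (P.smoothedPrimal μ u) := by
  constructor
  · refine ⟨(1 / μ) • (P.G u + P.g), ?_⟩
    simp only [lagrangian, smoothedPrimal, inner_smul_left, real_inner_self_eq_norm_sq, norm_smul,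
      mul_pow, Real.norm_eq_abs, sq_abs]
    simp
    field_simp
    ring
  · rintro _ ⟨x, rfl⟩
    have h : 0 ≤ ‖μ • x - (P.G u + P.g)‖ ^ 2 := by positivity
    rw [norm_sub_sq_real, inner_smul_left, norm_smul, Real.norm_eq_abs, abs_of_pos hμ] at h
    simp only [lagrangian, smoothedPrimal]
    have h2 : 1 / (2 * μ) * ‖P.G u + P.g‖ ^ 2 - inner ℝ x (P.G u + P.g) + μ / 2 * ‖x‖ ^ 2 =
        1 / (2 * μ) * ((μ * ‖x‖) ^ 2 - 2 * (μ * inner ℝ x (P.G u + P.g)) +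
          ‖P.G u + P.g‖ ^ 2) := by
      field_simp
      ring
    have h3 : 0 ≤ 1 / (2 * μ) * ((μ * ‖x‖) ^ 2 - 2 * (μ * inner ℝ x (P.G u + P.g)) +
          ‖P.G u + P.g‖ ^ 2) := mul_nonneg (by positivity) (by simpa using h)
    linarith

/-- The smoothed duality gap `f_μ(u) - d_ρ(x)`. -/
def smoothedGap (ρ μ : ℝ) (u : EuclideanSpace ℝ (Fin n)) (x : EuclideanSpace ℝ (Fin m)) : ℝ :=
  P.smoothedPrimal μ u - P.augDual ρ x

/-- The initial pairs for `IFAL(ρ, ε)`, `μ₀ = 4 / ρ`: either the smoothed duality gap is at most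
`δ₀`, or `u⁰` solves the inner subproblem at the multiplier `0` with accuracy `δ₀` and
`x⁰ = (G u⁰ + g) / μ₀`. -/
def IsInitialPair (ρ ε : ℝ) (u : EuclideanSpace ℝ (Fin n)) (x : EuclideanSpace ℝ (Fin m)) :
    Prop :=
  u ∈ P.U ∧
    (P.smoothedGap ρ (4 / ρ) u x ≤ ifalDelta ε 0 ∨
      (P.augLag ρ u 0 - P.augDual ρ 0 ≤ ifalDelta ε 0 ∧ x = (1 / (4 / ρ)) • (P.G u + P.g)))

/-- Nesterov's method on the inner subproblem `min_{u ∈ U}` of the augmented Lagrangian at the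
multiplier `x`, started at `v`, after `N` iterations. -/
def innerSolve (Lf ρ : ℝ) (x : EuclideanSpace ℝ (Fin m)) (v : EuclideanSpace ℝ (Fin n)) (N : ℕ) :
    NesterovState n :=
  nesterov (fun u => P.augLag ρ u x) (Lf + ρ * ‖P.G‖ ^ 2) P.U v N

/-- `x̂ᵏ = (1 - τ_k) xᵏ + (τ_k / μ_k) (G uᵏ + g)`. -/
def xhat (k : ℕ) (s : IFALState n m) : EuclideanSpace ℝ (Fin m) :=
  (1 - ifalTau k) • s.x + (ifalTau k / s.mu) • (P.G s.u + P.g)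

/-- Outer iteration `k` of IFAL, in which the inner subproblem is solved by `N` iterations of
Nesterov's method started at `v`. -/
def ifalStep (Lf ρ : ℝ) (k : ℕ) (v : EuclideanSpace ℝ (Fin n)) (N : ℕ) (s : IFALState n m) :
    IFALState n m :=
  let r := P.innerSolve Lf ρ (P.xhat k s) v N
  { u := (1 - ifalTau k) • s.u + ifalTau k • r.point
    x := P.xhat k s + ρ • (P.G r.point + P.g)
    mu := (1 - ifalTau k) * s.mu
    projections := s.projections + r.projections }

/-- The IFAL method with parameter `ρ` from `(u⁰, x⁰)`, `μ₀ = 4 / ρ`: its state after `k` outer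
iterations, when the `j`-th inner call starts Nesterov's method at `v j` and stops it after `ν j`
iterations. -/
def ifal (Lf ρ : ℝ) (u₀ : EuclideanSpace ℝ (Fin n)) (x₀ : EuclideanSpace ℝ (Fin m))
    (v : ℕ → EuclideanSpace ℝ (Fin n)) (ν : ℕ → ℕ) : ℕ → IFALState n m
  | 0 => { u := u₀, x := x₀, mu := 4 / ρ, projections := 0 }
  | k + 1 => P.ifalStep Lf ρ k (v k) (ν k) (ifal Lf ρ u₀ x₀ v ν k)

/-- In this run, `N` iterations of Nesterov's method in the `k`-th inner call give an approximate
solution of the inner subproblem at `x̂ᵏ` with accuracy `δ_k`. -/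
def CallAccurate (Lf ρ ε : ℝ) (u₀ : EuclideanSpace ℝ (Fin n)) (x₀ : EuclideanSpace ℝ (Fin m))
    (v : ℕ → EuclideanSpace ℝ (Fin n)) (ν : ℕ → ℕ) (k N : ℕ) : Prop :=
  P.augLag ρ (P.innerSolve Lf ρ (P.xhat k (P.ifal Lf ρ u₀ x₀ v ν k)) (v k) N).point
      (P.xhat k (P.ifal Lf ρ u₀ x₀ v ν k))
    - P.augDual ρ (P.xhat k (P.ifal Lf ρ u₀ x₀ v ν k)) ≤ ifalDelta ε k

/-- The inner complexity estimate `2 D_U √((L_f + ρ ‖G‖²) / δ_k)`, rounded down, but at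
least one. -/
def innerBound (Lf ρ ε : ℝ) (k : ℕ) : ℕ :=
  max 1 ⌊2 * Metric.diam P.U * √((Lf + ρ * ‖P.G‖ ^ 2) / ifalDelta ε k)⌋₊

/-- The real number `√(6 L_f D_U² / ε) + 4 √6 D_U ‖G‖ X / ε`. -/
def projEstimate (Lf X ε : ℝ) : ℝ :=
  √(6 * Lf * Metric.diam P.U ^ 2 / ε) + 4 * √6 * Metric.diam P.U * ‖P.G‖ * X / ε

end LinProblem

/-- The smoothing parameter `16 X² / ε`. -/
def rhoOpt (X ε : ℝ) : ℝ := 16 * X ^ 2 / ε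

/-- The outer complexity estimate: one iteration if `ρ ≥ 16 X² / ε`, and otherwise
`2^{5/2} X / √(ρ ε)`, rounded up. -/
def outerBound (X ρ ε : ℝ) : ℕ :=
  if rhoOpt X ε ≤ ρ then 1 else ⌈4 * √2 * X / √(ρ * ε)⌉₊

/-- The total complexity estimate of IFAL as a function of `ρ`. -/
def LinProblem.totalBound {n m : ℕ} (P : LinProblem n m) (Lf X ρ ε : ℝ) : ℕ :=
  ∑ k ∈ Finset.range (outerBound X ρ ε), P.innerBound Lf ρ ε k

end

/-! Everything is measured by the smoothed gap `f_μ(u) - d_ρ(x)`. By weak duality and the saddle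
inequality `f* ≤ f(u) + ⟨x*, Gu + g⟩`, a gap at most `ε` together with `4 μ ‖x*‖² ≤ ε` forces
`ε`-optimality (`isEpsOptimal_of_smoothedGap_le`). Since `μ_k = 8 / (ρ (k+1) (k+2))`, the condition
on `μ` decides how many outer steps are needed, and `ρ₀` makes one step enough.

The gap is controlled through the curvature of the augmented Lagrangian in `Gu + g`. A `δ`-minimizer
gives a quadratic minorant of `d_ρ` with curvature `1 / (ρ θ)` and error `δ / (1 - θ)`, for any `θ`
in `(0, 1)` (`augDual_ge_of_approx`). Inserted in one outer step, it contracts the gap by `1 - τ_k`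
up to that error (`smoothedGap_step`). The choice `θ = 2/3` works for all `k` and keeps the gap
below `3ε/4`. For the first step alone there is slack: `θ = 1/2` is admissible and tolerates the
inner accuracy `2 δ₀`, so `⌊B⌋` inner iterations suffice for `ε`-optimality from any starting point.

Inner costs come from Nesterov's rate `2 L r² / (N+1)²` (`nesterov_rate`), where `r` bounds the
distance from the start to the points of `U`. A Chebyshev center of `U` in `U` has `r ≤ D_U / √2`,
which halves `r²` and thus compensates for asking `δ₀` instead of `2 δ₀`.

For the comparison of parameters, let `ρ < ρ₀`. The growth of `N(ρ)` gives `N(ρ)² ρ ≥ ρ₀`, so `N(ρ)`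
calls at `ρ` cost at least as much as one at `ρ₀`, the factor 2 absorbing the rounding
(`totalBound_rhoOpt_le`). -/

/-! ### First order bounds for smooth convex functions -/

section GradientInequalities

variable {E : Type*} [NormedAddCommGroup E] [InnerProductSpace ℝ E] [CompleteSpace E]

theorem hasDerivAt_comp_segment_of_differentiable {f : E → ℝ} (hf : Differentiable ℝ f) (y d : E)
    (s : ℝ) : HasDerivAt (fun s : ℝ => f (y + s • d)) (inner ℝ (gradient f (y + s • d)) d) s := by
  have h1 := (hf (y + s • d)).hasGradientAt.hasFDerivAt
  have h2 : HasDerivAt (fun s : ℝ => y + s • d) d s := by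
    simpa using ((hasDerivAt_id s).smul_const d).const_add y
  exact h1.comp_hasDerivAt s h2

/-- The descent lemma. -/
theorem le_add_inner_gradient_of_lipschitz {f : E → ℝ} {L : ℝ} (hf : Differentiable ℝ f)
    (hL : ∀ u v, ‖gradient f u - gradient f v‖ ≤ L * ‖u - v‖) (y w : E) :
    f w ≤ f y + inner ℝ (gradient f y) (w - y) + L / 2 * ‖w - y‖ ^ 2 := by
  set d := w - y with hd
  have hder : ∀ s : ℝ, HasDerivAt (fun s : ℝ => f (y + s • d) -
      (s * inner ℝ (gradient f y) d + L / 2 * ‖d‖ ^ 2 * s ^ 2))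
      (inner ℝ (gradient f (y + s • d)) d -
        (1 * inner ℝ (gradient f y) d + L / 2 * ‖d‖ ^ 2 * (2 * s))) s := fun s => by
    refine (hasDerivAt_comp_segment_of_differentiable hf y d s).sub
      (((hasDerivAt_id s).mul_const _).add ?_)
    simpa using (hasDerivAt_pow 2 s).const_mul (L / 2 * ‖d‖ ^ 2)
  -- The Lipschitz bound makes the derivative of the difference nonpositive on `[0, 1]`, so no
  -- integral is needed.
  have hanti : AntitoneOn (fun s : ℝ => f (y + s • d) -
      (s * inner ℝ (gradient f y) d + L / 2 * ‖d‖ ^ 2 * s ^ 2)) (Set.Icc 0 1) := by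
    refine antitoneOn_of_deriv_nonpos (convex_Icc 0 1)
      (fun s _ => (hder s).continuousAt.continuousWithinAt)
      (fun s _ => (hder s).differentiableAt.differentiableWithinAt) fun s hs => ?_
    rw [(hder s).deriv]
    rw [interior_Icc] at hs
    have h1 := real_inner_le_norm (gradient f (y + s • d) - gradient f y) d
    have h2 := hL (y + s • d) y
    rw [add_sub_cancel_left, norm_smul, Real.norm_eq_abs, abs_of_pos hs.1] at h2
    rw [inner_sub_left] at h1
    nlinarith [mul_le_mul_of_nonneg_right h2 (norm_nonneg d)]
  have h := hanti (Set.left_mem_Icc.2 zero_le_one) (Set.right_mem_Icc.2 zero_le_one) zero_le_one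
  simp only [zero_smul, one_smul, add_zero, hd, add_sub_cancel] at h
  rw [← hd] at h
  linarith

/-- A convex differentiable function lies above its tangent planes. -/
theorem add_inner_gradient_le_of_convexOn {f : E → ℝ} (hf : Differentiable ℝ f)
    (hc : ConvexOn ℝ Set.univ f) (y w : E) : f y + inner ℝ (gradient f y) (w - y) ≤ f w := by
  have hline : ConvexOn ℝ Set.univ (fun s : ℝ => f (y + s • (w - y))) := by
    refine ⟨convex_univ, fun a _ b _ p q hp hq hpq => ?_⟩
    have h := hc.2 (Set.mem_univ (y + a • (w - y))) (Set.mem_univ (y + b • (w - y))) hp hq hpq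
    convert h using 2
    obtain rfl : q = 1 - p := by linarith
    simp only [smul_eq_mul]
    module
  have h := hline.le_slope_of_hasDerivAt (Set.mem_univ 0) (Set.mem_univ 1) zero_lt_one
    (hasDerivAt_comp_segment_of_differentiable hf y (w - y) 0)
  simp only [slope_def_field, zero_smul, add_zero, one_smul, add_sub_cancel, sub_zero,
    div_one] at h
  linarith

end GradientInequalities

/-! ### Convergence rate of the accelerated projected gradient method -/

section Nesterov

variable {n : ℕ} {U : Set (EuclideanSpace ℝ (Fin n))}

theorem inner_sub_metricProj_le_zero (hne : U.Nonempty) (hcl : IsClosed U) (hcv : Convex ℝ U)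
    (y : EuclideanSpace ℝ (Fin n)) {u : EuclideanSpace ℝ (Fin n)} (hu : u ∈ U) :
    inner ℝ (y - metricProj U y) (u - metricProj U y) ≤ 0 := by
  obtain ⟨hp, hmin⟩ := metricProj_spec hne hcl y
  have : Nonempty U := hne.to_subtype
  refine (norm_eq_iInf_iff_real_inner_le_zero hcv hp).1 (le_antisymm ?_ ?_) u hu
  · exact le_ciInf fun w => hmin w w.2
  · exact ciInf_le (f := fun w : U => ‖y - w‖) ⟨0, by rintro _ ⟨w, rfl⟩; positivity⟩ ⟨_, hp⟩

/-- The basic inequality for a projected gradient step of length `1 / L`. -/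
theorem projectedGradient_le {Φ : EuclideanSpace ℝ (Fin n) → ℝ} {L : ℝ} (hL : 0 < L)
    (hne : U.Nonempty) (hcl : IsClosed U) (hcv : Convex ℝ U)
    (hlow : ∀ y w, Φ y + inner ℝ (gradient Φ y) (w - y) ≤ Φ w)
    (hup : ∀ y w, Φ w ≤ Φ y + inner ℝ (gradient Φ y) (w - y) + L / 2 * ‖w - y‖ ^ 2)
    (y : EuclideanSpace ℝ (Fin n)) {u : EuclideanSpace ℝ (Fin n)} (hu : u ∈ U) :
    Φ (metricProj U (y - (1 / L) • gradient Φ y)) +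
        L / 2 * ‖metricProj U (y - (1 / L) • gradient Φ y) - u‖ ^ 2 ≤
      Φ u + L / 2 * ‖y - u‖ ^ 2 := by
  have h := inner_sub_metricProj_le_zero hne hcl hcv (y - (1 / L) • gradient Φ y) hu
  set p := metricProj U (y - (1 / L) • gradient Φ y)
  set q := gradient Φ y
  have h1 := hlow y u
  have h2 := hup y p
  have h3 : inner ℝ (y - p) (u - p) * L ≤ inner ℝ q (u - p) := by
    have h4 : y - (1 / L) • q - p = (y - p) - (1 / L) • q := by abel
    rw [h4, inner_sub_left, real_inner_smul_left, sub_nonpos, one_div,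
      ← div_eq_inv_mul, le_div_iff₀ hL] at h
    exact h
  have h5 : inner ℝ q (u - y) - inner ℝ q (p - y) = inner ℝ q (u - p) := by
    rw [← inner_sub_right]; congr 1; abel
  have h6 : ‖y - u‖ ^ 2 = ‖p - y‖ ^ 2 - 2 * inner ℝ (y - p) (u - p) + ‖p - u‖ ^ 2 := by
    rw [norm_sub_rev p y, norm_sub_rev p u, ← norm_sub_sq_real]
    congr 2; abel
  rw [h6]
  linarith

theorem nesterov_zero (Φ : EuclideanSpace ℝ (Fin n) → ℝ) (L : ℝ) (v : EuclideanSpace ℝ (Fin n)) :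
    nesterov Φ L U v 0 = { point := v, extrap := v, t := 1, projections := 0 } := rfl

theorem nesterov_succ (Φ : EuclideanSpace ℝ (Fin n) → ℝ) (L : ℝ) (v : EuclideanSpace ℝ (Fin n))
    (N : ℕ) : nesterov Φ L U v (N + 1) = nesterovStep Φ L U (nesterov Φ L U v N) :=
  Function.iterate_succ_apply' _ _ _

theorem nesterov_projections (Φ : EuclideanSpace ℝ (Fin n) → ℝ) (L : ℝ)
    (v : EuclideanSpace ℝ (Fin n)) (N : ℕ) : (nesterov Φ L U v N).projections = N := by
  induction N with
  | zero => rfl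
  | succ N ih => rw [nesterov_succ]; simp [nesterovStep, ih]

theorem nesterov_point_mem (Φ : EuclideanSpace ℝ (Fin n) → ℝ) (L : ℝ) (hcl : IsClosed U)
    {v : EuclideanSpace ℝ (Fin n)} (hv : v ∈ U) (N : ℕ) : (nesterov Φ L U v N).point ∈ U := by
  cases N with
  | zero => exact hv
  | succ N => rw [nesterov_succ]; exact (metricProj_spec ⟨v, hv⟩ hcl _).1

theorem nesterov_le_t (Φ : EuclideanSpace ℝ (Fin n) → ℝ) (L : ℝ)
    (v : EuclideanSpace ℝ (Fin n)) (N : ℕ) : 1 + (N : ℝ) / 2 ≤ (nesterov Φ L U v N).t := by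
  induction N with
  | zero => simp [nesterov_zero]
  | succ N ih =>
    rw [nesterov_succ]
    simp only [nesterovStep]
    set t := (nesterov Φ L U v N).t
    have : 2 * t ≤ √(1 + 4 * t ^ 2) := Real.le_sqrt_of_sq_le (by nlinarith)
    push_cast
    linarith

/-- The next scalar `t'` of Nesterov's method satisfies `t' ^ 2 - t' = t ^ 2`. -/
theorem nesterovStep_t (Φ : EuclideanSpace ℝ (Fin n) → ℝ) (L : ℝ) (s : NesterovState n) :
    (nesterovStep Φ L U s).t ^ 2 - (nesterovStep Φ L U s).t = s.t ^ 2 := by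
  have h := Real.sq_sqrt (show 0 ≤ 1 + 4 * s.t ^ 2 by positivity)
  simp only [nesterovStep]
  linarith

theorem nesterovStep_t_pos (Φ : EuclideanSpace ℝ (Fin n) → ℝ) (L : ℝ) (s : NesterovState n) :
    0 < (nesterovStep Φ L U s).t := by
  simp only [nesterovStep]
  positivity

/-- The extrapolation weight is chosen exactly for this: the vector in the Lyapunov function after a
step, built from the new `t`, is the one that the step inequality controls with the old `t`. -/
theorem nesterovStep_aux (Φ : EuclideanSpace ℝ (Fin n) → ℝ) (L : ℝ) (s : NesterovState n) :
    (nesterovStep Φ L U s).t • (nesterovStep Φ L U s).extrap -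
        ((nesterovStep Φ L U s).t - 1) • (nesterovStep Φ L U s).point =
      s.t • (nesterovStep Φ L U s).point - (s.t - 1) • s.point := by
  have h := (nesterovStep_t_pos (U := U) Φ L s).ne'
  have he : (nesterovStep Φ L U s).extrap = (nesterovStep Φ L U s).point +
      ((s.t - 1) / (nesterovStep Φ L U s).t) • ((nesterovStep Φ L U s).point - s.point) := rfl
  rw [he, smul_add, smul_smul, mul_div_cancel₀ _ h]
  module

/-- The Lyapunov function of Nesterov's method does not increase. -/
theorem nesterovStep_lyapunov {Φ : EuclideanSpace ℝ (Fin n) → ℝ} {L : ℝ} (hL : 0 < L)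
    (hne : U.Nonempty) (hcl : IsClosed U) (hcv : Convex ℝ U)
    (hlow : ∀ y w, Φ y + inner ℝ (gradient Φ y) (w - y) ≤ Φ w)
    (hup : ∀ y w, Φ w ≤ Φ y + inner ℝ (gradient Φ y) (w - y) + L / 2 * ‖w - y‖ ^ 2)
    {s : NesterovState n} (hs : s.point ∈ U) (ht : 1 ≤ s.t)
    {u : EuclideanSpace ℝ (Fin n)} (hu : u ∈ U) :
    s.t ^ 2 * (Φ (nesterovStep Φ L U s).point - Φ u) + L / 2 *
        ‖s.t • (nesterovStep Φ L U s).point - (s.t - 1) • s.point - u‖ ^ 2 ≤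
      (s.t ^ 2 - s.t) * (Φ s.point - Φ u) +
        L / 2 * ‖s.t • s.extrap - (s.t - 1) • s.point - u‖ ^ 2 := by
  have h1 := projectedGradient_le hL hne hcl hcv hlow hup s.extrap hs
  have h2 := projectedGradient_le hL hne hcl hcv hlow hup s.extrap hu
  have hp : metricProj U (s.extrap - (1 / L) • gradient Φ s.extrap) =
    (nesterovStep Φ L U s).point := rfl
  rw [hp] at h1 h2
  set p := (nesterovStep Φ L U s).point
  set t := s.t
  set z := s.point
  -- With this identity the claim is `t (t - 1)` times the step inequality at `z` plus `t` times the
  -- one at `u`; the terms in `‖z - u‖²` cancel.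
  have key : ∀ a : EuclideanSpace ℝ (Fin n), ‖t • a - (t - 1) • z - u‖ ^ 2 =
      t * (t - 1) * ‖a - z‖ ^ 2 + t * ‖a - u‖ ^ 2 - (t - 1) * ‖z - u‖ ^ 2 := fun a => by
    have e1 : t • a - (t - 1) • z - u = (t - 1) • (a - z) + (a - u) := by module
    have e2 : z - u = (a - u) - (a - z) := by abel
    rw [e1, e2]
    generalize a - z = b
    generalize a - u = c
    rw [norm_add_sq_real, norm_sub_sq_real, norm_smul, mul_pow, Real.norm_eq_abs, sq_abs,
      real_inner_smul_left, real_inner_comm b]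
    ring
  rw [key, key]
  have h3 := mul_le_mul_of_nonneg_left h1 (show 0 ≤ t * (t - 1) by nlinarith)
  have h4 := mul_le_mul_of_nonneg_left h2 (show 0 ≤ t by linarith)
  linarith

/-- Since `t = 1` initially, `t² - t = 0` and the starting value of `Φ` does not enter the bound. -/
theorem nesterov_lyapunov {Φ : EuclideanSpace ℝ (Fin n) → ℝ} {L : ℝ} (hL : 0 < L)
    (hcl : IsClosed U) (hcv : Convex ℝ U)
    (hlow : ∀ y w, Φ y + inner ℝ (gradient Φ y) (w - y) ≤ Φ w)
    (hup : ∀ y w, Φ w ≤ Φ y + inner ℝ (gradient Φ y) (w - y) + L / 2 * ‖w - y‖ ^ 2)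
    {v u : EuclideanSpace ℝ (Fin n)} (hv : v ∈ U) (hu : u ∈ U) (N : ℕ) :
    ((nesterov Φ L U v N).t ^ 2 - (nesterov Φ L U v N).t) *
        (Φ (nesterov Φ L U v N).point - Φ u) +
      L / 2 * ‖(nesterov Φ L U v N).t • (nesterov Φ L U v N).extrap -
        ((nesterov Φ L U v N).t - 1) • (nesterov Φ L U v N).point - u‖ ^ 2 ≤
      L / 2 * ‖v - u‖ ^ 2 := by
  induction N with
  | zero => simp [nesterov_zero]
  | succ N ih =>
    rw [nesterov_succ, nesterovStep_t, nesterovStep_aux]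
    refine le_trans (nesterovStep_lyapunov hL ⟨v, hv⟩ hcl hcv hlow hup
      (nesterov_point_mem Φ L hcl hv N) ?_ hu) ih
    have := nesterov_le_t (U := U) Φ L v N
    have : (0 : ℝ) ≤ N := N.cast_nonneg
    linarith

/-- The `O(1 / N²)` rate of Nesterov's method. -/
theorem nesterov_rate {Φ : EuclideanSpace ℝ (Fin n) → ℝ} {L : ℝ} (hL : 0 < L)
    (hcl : IsClosed U) (hcv : Convex ℝ U)
    (hlow : ∀ y w, Φ y + inner ℝ (gradient Φ y) (w - y) ≤ Φ w)
    (hup : ∀ y w, Φ w ≤ Φ y + inner ℝ (gradient Φ y) (w - y) + L / 2 * ‖w - y‖ ^ 2)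
    {v u : EuclideanSpace ℝ (Fin n)} (hv : v ∈ U) (hu : u ∈ U) {N : ℕ} (hN : 1 ≤ N) :
    Φ (nesterov Φ L U v N).point - Φ u ≤ 2 * L * ‖v - u‖ ^ 2 / ((N : ℝ) + 1) ^ 2 := by
  -- The weight `t² - t` after `N = M + 1` steps is the square of the scalar after `M` steps, which
  -- is at least `(N + 1) / 2`.
  obtain ⟨M, rfl⟩ : ∃ M, N = M + 1 := ⟨N - 1, by omega⟩
  have h := nesterov_lyapunov hL hcl hcv hlow hup hv hu (M + 1)
  have ht := nesterov_le_t (U := U) Φ L v M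
  rw [nesterov_succ, nesterovStep_t] at h
  rw [nesterov_succ]
  have h0 : 0 ≤ L / 2 * ‖(nesterovStep Φ L U (nesterov Φ L U v M)).t •
      (nesterovStep Φ L U (nesterov Φ L U v M)).extrap -
      ((nesterovStep Φ L U (nesterov Φ L U v M)).t - 1) •
        (nesterovStep Φ L U (nesterov Φ L U v M)).point - u‖ ^ 2 := by positivity
  set e := Φ (nesterovStep Φ L U (nesterov Φ L U v M)).point - Φ u
  set t := (nesterov Φ L U v M).t
  rw [le_div_iff₀ (by positivity)]
  push_cast
  rcases le_total e 0 with he | he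
  · exact (mul_nonpos_of_nonpos_of_nonneg he (by positivity)).trans (by positivity)
  · have h1 : ((M : ℝ) + 1 + 1) ^ 2 ≤ 4 * t ^ 2 := by
      have : (0 : ℝ) ≤ M := M.cast_nonneg
      nlinarith
    nlinarith [mul_le_mul_of_nonneg_left h1 he]

end Nesterov

/-! ### A center of a compact convex set, with a dimension-free radius bound -/

section Circumcenter

variable {E : Type*} [NormedAddCommGroup E] [InnerProductSpace ℝ E]

/-- A compact convex set contains a point whose distance to every point of the set is at most
`1 / √2` times the diameter. -/
theorem IsCompact.exists_norm_sub_le_diam_div_sqrt_two {U : Set E} (hU : IsCompact U)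
    (hcv : Convex ℝ U) (hne : U.Nonempty) :
    ∃ c ∈ U, ∀ u ∈ U, ‖c - u‖ ≤ Metric.diam U / √2 := by
  have hR : Continuous fun c => sSup ((fun u => ‖c - u‖) '' U) :=
    hU.continuous_sSup (f := fun c u => ‖c - u‖) (by fun_prop)
  obtain ⟨c, hc, hmin⟩ := hU.exists_isMinOn hne hR.continuousOn
  have hfar : ∀ a, ∃ w ∈ U, sSup ((fun u => ‖a - u‖) '' U) = ‖a - w‖ := fun a => by
    obtain ⟨w, hw, h1, -⟩ := hU.exists_sSup_image_eq_and_ge hne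
      (f := fun u => ‖a - u‖) (by fun_prop)
    exact ⟨w, hw, h1⟩
  have hle : ∀ a, ∀ u ∈ U, ‖a - u‖ ≤ sSup ((fun u => ‖a - u‖) '' U) := fun a u hu =>
    le_csSup (hU.image (by fun_prop)).bddAbove ⟨u, hu, rfl⟩
  refine ⟨c, hc, fun u hu => (hle c u hu).trans ?_⟩
  obtain ⟨w, hw, hcw⟩ := hfar c
  set R := sSup ((fun u => ‖c - u‖) '' U) with hRdef
  have hR0 : 0 ≤ R := hcw ▸ norm_nonneg _
  -- Take `c` minimizing the farthest distance `R`, and `w` farthest from `c`. After a move of `c`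
  -- towards `w`, minimality leaves a point `p` at distance at least `R`. As `t → 0`, `‖c - p‖`
  -- tends to `R` and the angle at `c` between `w` and `p` is in the limit not acute, hence `‖w -
  -- p‖² ≥ 2 R²` up to `O(t)`.
  have key : ∀ t : ℝ, 0 < t → t ≤ 1 → 2 * R ^ 2 - 3 * R ^ 2 * t ≤ Metric.diam U ^ 2 := by
    intro t ht0 ht1
    have hct : c + t • (w - c) ∈ U := by
      convert hcv hc hw (sub_nonneg.2 ht1) ht0.le (by ring) using 1
      module
    obtain ⟨p, hp, hpe⟩ := hfar (c + t • (w - c))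
    have h1 : R ≤ ‖c + t • (w - c) - p‖ := hpe ▸ hmin hct
    have h2 : ‖c - p‖ ≤ R := hle c p hp
    have h3 : ‖w - p‖ ≤ Metric.diam U := by
      rw [← dist_eq_norm]; exact Metric.dist_le_diam_of_mem hU.isBounded hw hp
    have e1 : c + t • (w - c) - p = (c - p) + t • (w - c) := by abel
    have e2 : w - p = (c - p) + (w - c) := by abel
    have h4 : ‖c + t • (w - c) - p‖ ≤ ‖c - p‖ + t * R := by
      rw [e1, hcw, norm_sub_rev c w]
      refine (norm_add_le _ _).trans ?_
      rw [norm_smul, Real.norm_eq_abs, abs_of_pos ht0]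
    have h5 : R ^ 2 ≤ ‖c - p‖ ^ 2 + 2 * t * inner ℝ (c - p) (w - c) + t ^ 2 * R ^ 2 := by
      calc R ^ 2 ≤ ‖c + t • (w - c) - p‖ ^ 2 := by gcongr
        _ = _ := by
          rw [e1, norm_add_sq_real, real_inner_smul_right, norm_smul, mul_pow, Real.norm_eq_abs,
            sq_abs, norm_sub_rev w c, ← hcw]
          ring
    have h6 : ‖w - p‖ ^ 2 = ‖c - p‖ ^ 2 + 2 * inner ℝ (c - p) (w - c) + R ^ 2 := by
      rw [e2, norm_add_sq_real, norm_sub_rev w c, ← hcw]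
    have h7 : ‖w - p‖ ^ 2 ≤ Metric.diam U ^ 2 := by gcongr
    have h8 : ‖c - p‖ ^ 2 ≤ R ^ 2 := by gcongr
    have h9 : -(t * R ^ 2) ≤ 2 * inner ℝ (c - p) (w - c) := by
      refine le_of_mul_le_mul_left ?_ ht0
      nlinarith
    have h10 : ((1 - t) * R) ^ 2 ≤ ‖c - p‖ ^ 2 := by
      have : 0 ≤ (1 - t) * R := mul_nonneg (by linarith) hR0
      gcongr
      linarith
    nlinarith [mul_nonneg (sq_nonneg t) (sq_nonneg R)]
  have hlim : 2 * R ^ 2 ≤ Metric.diam U ^ 2 := by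
    refine le_of_forall_pos_le_add fun η hη => ?_
    have hpos : 0 < 3 * R ^ 2 + 1 := by positivity
    have h := key (min 1 (η / (3 * R ^ 2 + 1))) (by positivity) (min_le_left _ _)
    have h2 : 3 * R ^ 2 * min 1 (η / (3 * R ^ 2 + 1)) ≤ η := by
      calc 3 * R ^ 2 * min 1 (η / (3 * R ^ 2 + 1))
          ≤ (3 * R ^ 2 + 1) * (η / (3 * R ^ 2 + 1)) := by
            gcongr
            · linarith
            · exact min_le_right _ _
        _ = η := mul_div_cancel₀ _ hpos.ne'
    linarith
  rw [le_div_iff₀ (by positivity)]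
  refine abs_le_of_sq_le_sq' ?_ Metric.diam_nonneg |>.2
  rw [mul_pow, Real.sq_sqrt (by norm_num)]
  linarith

end Circumcenter

namespace LinProblem

variable {n m : ℕ} {P : LinProblem n m} {Lf : ℝ}

/-! ### Smoothness, convexity and weak duality for the augmented Lagrangian -/

section AugmentedLagrangian

theorem augLag_add_inner (P : LinProblem n m) (ρ : ℝ) (u : EuclideanSpace ℝ (Fin n))
    (x y : EuclideanSpace ℝ (Fin m)) :
    P.augLag ρ u y = P.augLag ρ u x + inner ℝ (y - x) (P.G u + P.g) := by
  simp only [augLag, inner_sub_left]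
  ring

/-- Second order expansion of the quadratic part of the augmented Lagrangian. -/
theorem augLag_expand (P : LinProblem n m) (ρ : ℝ) (x : EuclideanSpace ℝ (Fin m))
    (y d : EuclideanSpace ℝ (Fin n)) (s : ℝ) :
    P.augLag ρ (y + s • d) x = P.f (y + s • d) + (P.augLag ρ y x - P.f y +
      s * (inner ℝ x (P.G d) + ρ * inner ℝ (P.G y + P.g) (P.G d)) +
        ρ / 2 * ‖P.G d‖ ^ 2 * s ^ 2) := by
  have h : P.G (y + s • d) + P.g = (P.G y + P.g) + s • P.G d := by
    rw [map_add, map_smul]; abel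
  simp only [augLag, h]
  rw [inner_add_right, norm_add_sq_real, real_inner_smul_right, real_inner_smul_right, norm_smul,
    mul_pow, Real.norm_eq_abs, sq_abs]
  ring

theorem differentiable_augLag (hf : Differentiable ℝ P.f) (ρ : ℝ)
    (x : EuclideanSpace ℝ (Fin m)) : Differentiable ℝ fun u => P.augLag ρ u x := by
  have h : Differentiable ℝ fun u => P.G u + P.g := P.G.differentiable.add_const _
  exact (hf.add ((differentiable_const x).inner ℝ h)).add ((h.norm_sq ℝ).const_mul _)

/-- Both sides are the derivative at 0 along the line through `y` in direction `d`; uniqueness of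
derivatives avoids the adjoint of `G`. -/
theorem inner_gradient_augLag (hf : Differentiable ℝ P.f) (ρ : ℝ) (x : EuclideanSpace ℝ (Fin m))
    (y d : EuclideanSpace ℝ (Fin n)) :
    inner ℝ (gradient (fun u => P.augLag ρ u x) y) d = inner ℝ (gradient P.f y) d +
      (inner ℝ x (P.G d) + ρ * inner ℝ (P.G y + P.g) (P.G d)) := by
  have h1 := hasDerivAt_comp_segment_of_differentiable (differentiable_augLag hf ρ x) y d 0
  have h2 := hasDerivAt_comp_segment_of_differentiable hf y d 0
  have h3 : HasDerivAt (fun s : ℝ => P.augLag ρ (y + s • d) x)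
      (inner ℝ (gradient P.f (y + (0 : ℝ) • d)) d +
        (1 * (inner ℝ x (P.G d) + ρ * inner ℝ (P.G y + P.g) (P.G d)) +
          ρ / 2 * ‖P.G d‖ ^ 2 * (2 * 0))) 0 := by
    simp only [augLag_expand]
    refine h2.add (((hasDerivAt_id (0 : ℝ)).mul_const _).const_add _ |>.add ?_)
    simpa using (hasDerivAt_pow 2 (0 : ℝ)).const_mul (ρ / 2 * ‖P.G d‖ ^ 2)
  have h := h1.unique h3
  rw [zero_smul, add_zero] at h
  rw [h]
  ring

theorem augLag_gradient_le (hP : P.Standing Lf) {ρ : ℝ} (hρ : 0 ≤ ρ)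
    (x : EuclideanSpace ℝ (Fin m)) (y w : EuclideanSpace ℝ (Fin n)) :
    P.augLag ρ y x + inner ℝ (gradient (fun u => P.augLag ρ u x) y) (w - y) ≤
      P.augLag ρ w x := by
  have h := augLag_expand P ρ x y (w - y) 1
  have h2 := add_inner_gradient_le_of_convexOn hP.differentiable_f hP.convex_f y w
  rw [one_smul, add_sub_cancel] at h
  rw [inner_gradient_augLag hP.differentiable_f, h]
  have h3 : 0 ≤ ρ / 2 * ‖P.G (w - y)‖ ^ 2 := by positivity
  linarith

theorem augLag_le_gradient (hP : P.Standing Lf) {ρ : ℝ} (hρ : 0 ≤ ρ)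
    (x : EuclideanSpace ℝ (Fin m)) (y w : EuclideanSpace ℝ (Fin n)) :
    P.augLag ρ w x ≤ P.augLag ρ y x +
      inner ℝ (gradient (fun u => P.augLag ρ u x) y) (w - y) +
        (Lf + ρ * ‖P.G‖ ^ 2) / 2 * ‖w - y‖ ^ 2 := by
  have h := augLag_expand P ρ x y (w - y) 1
  have h2 := le_add_inner_gradient_of_lipschitz hP.differentiable_f hP.lipschitz_gradient y w
  rw [one_smul, add_sub_cancel] at h
  rw [inner_gradient_augLag hP.differentiable_f, h]
  have h3 : ρ / 2 * ‖P.G (w - y)‖ ^ 2 ≤ ρ / 2 * (‖P.G‖ * ‖w - y‖) ^ 2 := by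
    gcongr
    exact P.G.le_opNorm _
  linarith

theorem Standing.isCompact_U (hP : P.Standing Lf) : IsCompact P.U :=
  Metric.isCompact_of_isClosed_isBounded hP.closed_U hP.bounded_U

theorem augDual_le (hP : P.Standing Lf) (ρ : ℝ) (x : EuclideanSpace ℝ (Fin m))
    {u : EuclideanSpace ℝ (Fin n)} (hu : u ∈ P.U) : P.augDual ρ x ≤ P.augLag ρ u x :=
  csInf_le (hP.isCompact_U.image
    (differentiable_augLag hP.differentiable_f ρ x).continuous).bddBelow ⟨u, hu, rfl⟩

theorem le_augDual (hP : P.Standing Lf) {ρ : ℝ} {x : EuclideanSpace ℝ (Fin m)} {c : ℝ}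
    (h : ∀ u ∈ P.U, c ≤ P.augLag ρ u x) : c ≤ P.augDual ρ x :=
  le_csInf (hP.nonempty_U.image _) (by rintro _ ⟨u, hu, rfl⟩; exact h u hu)

theorem exists_solution (hP : P.Standing Lf) :
    ∃ u ∈ P.U, P.G u + P.g = 0 ∧ P.f u = P.optVal := by
  obtain ⟨u, hu, hmin⟩ := hP.nonempty_solutions
  have h : IsLeast (P.f '' P.feasible) (P.f u) :=
    ⟨⟨u, hu, rfl⟩, by rintro _ ⟨v, hv, rfl⟩; exact hmin v hv⟩
  exact ⟨u, hu.1, hu.2, h.csInf_eq.symm⟩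

theorem augDual_le_optVal (hP : P.Standing Lf) (ρ : ℝ) (x : EuclideanSpace ℝ (Fin m)) :
    P.augDual ρ x ≤ P.optVal := by
  obtain ⟨u, hu, h0, hf⟩ := exists_solution hP
  refine (augDual_le hP ρ x hu).trans_eq ?_
  simp [augLag, h0, hf]

/-- The dual function is `augDual` at `ρ = 0`, so the lower bound obtained from compactness applies
to it as well. -/
theorem optVal_le_lagrangian (hP : P.Standing Lf) {xs : EuclideanSpace ℝ (Fin m)}
    (hxs : P.IsOptimalMultiplier xs) {u : EuclideanSpace ℝ (Fin n)} (hu : u ∈ P.U) :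
    P.optVal ≤ P.lagrangian u xs := by
  have h : P.augDual 0 xs = P.dual xs := by simp [augDual, dual, augLag, lagrangian]
  rw [← hxs.1, ← h]
  refine (augDual_le hP 0 xs hu).trans_eq ?_
  simp [augLag, lagrangian]

end AugmentedLagrangian

/-! ### Quadratic minorants of the smoothed dual from inexact minimizers -/

section InexactOracle

variable {ρ δ : ℝ} {u w : EuclideanSpace ℝ (Fin n)} {x : EuclideanSpace ℝ (Fin m)}

/-- The augmented Lagrangian is strongly convex in `G u + g`. -/
theorem augLag_convexCombination_le (hP : P.Standing Lf) (ρ : ℝ) (x : EuclideanSpace ℝ (Fin m))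
    (u w : EuclideanSpace ℝ (Fin n)) {θ : ℝ} (h0 : 0 ≤ θ) (h1 : θ ≤ 1) :
    P.augLag ρ ((1 - θ) • u + θ • w) x ≤ (1 - θ) * P.augLag ρ u x + θ * P.augLag ρ w x -
      ρ / 2 * (θ * (1 - θ)) * ‖(P.G u + P.g) - (P.G w + P.g)‖ ^ 2 := by
  have hA : P.G ((1 - θ) • u + θ • w) + P.g = (1 - θ) • (P.G u + P.g) + θ • (P.G w + P.g) := by
    rw [map_add, map_smul, map_smul]; module
  have hf := hP.convex_f.2 (Set.mem_univ u) (Set.mem_univ w) (sub_nonneg.2 h1) h0 (by ring)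
  simp only [smul_eq_mul] at hf
  simp only [augLag, hA]
  generalize P.G u + P.g = a
  generalize P.G w + P.g = b
  rw [inner_add_right, norm_add_sq_real, norm_sub_sq_real, real_inner_smul_right,
    real_inner_smul_right, real_inner_smul_left, real_inner_smul_right, norm_smul, norm_smul,
    mul_pow, mul_pow, Real.norm_eq_abs, Real.norm_eq_abs, sq_abs, sq_abs]
  linarith

/-- The value at `(1 - θ) u + θ w` is at least the minimum; strong convexity in `Gu + g` bounds it
above, and division by `1 - θ` gives the claim. A larger `θ` retains more curvature but inflates the
error `δ`. -/
theorem augLag_ge_of_approx (hP : P.Standing Lf) (hu : u ∈ P.U) (hw : w ∈ P.U)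
    (h : P.augLag ρ w x - P.augDual ρ x ≤ δ) {θ : ℝ} (h0 : 0 < θ) (h1 : θ < 1) :
    P.augLag ρ w x - δ / (1 - θ) + ρ / 2 * θ * ‖(P.G u + P.g) - (P.G w + P.g)‖ ^ 2 ≤
      P.augLag ρ u x := by
  have hθ : 0 < 1 - θ := sub_pos.2 h1
  have h2 := augLag_convexCombination_le hP ρ x u w h0.le h1.le
  have h3 := augDual_le hP ρ x (hP.convex_U hu hw hθ.le h0.le (by ring))
  have h4 : δ / (1 - θ) * (1 - θ) = δ := div_mul_cancel₀ _ hθ.ne'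
  refine le_of_mul_le_mul_left ?_ hθ
  nlinarith

/-- An approximate minimizer of the augmented Lagrangian at `x` yields a quadratic lower bound
for the smoothed dual function. -/
theorem augDual_ge_of_approx (hP : P.Standing Lf) (hρ : 0 < ρ) (hw : w ∈ P.U)
    (h : P.augLag ρ w x - P.augDual ρ x ≤ δ) {θ : ℝ} (h0 : 0 < θ) (h1 : θ < 1)
    (y : EuclideanSpace ℝ (Fin m)) :
    P.augLag ρ w x + inner ℝ (y - x) (P.G w + P.g) - 1 / (2 * ρ * θ) * ‖y - x‖ ^ 2 -
      δ / (1 - θ) ≤ P.augDual ρ y := by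
  refine le_augDual hP fun u hu => ?_
  have h2 := augLag_ge_of_approx hP hu hw h h0 h1
  rw [augLag_add_inner P ρ u x y]
  generalize P.G u + P.g = a at *
  generalize P.G w + P.g = b at *
  -- Completing the square removes the dependence on the competitor `u`, which enters only through
  -- `a`.
  have h3 : 0 ≤ 1 / (2 * ρ * θ) * ‖(ρ * θ) • (a - b) + (y - x)‖ ^ 2 := by positivity
  have h4 : 1 / (2 * ρ * θ) * ‖(ρ * θ) • (a - b) + (y - x)‖ ^ 2 =
      ρ / 2 * θ * ‖a - b‖ ^ 2 + inner ℝ (y - x) (a - b) + 1 / (2 * ρ * θ) * ‖y - x‖ ^ 2 := by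
    rw [norm_add_sq_real, real_inner_smul_left, real_inner_comm, norm_smul, mul_pow,
      Real.norm_eq_abs, sq_abs]
    field_simp
  rw [inner_sub_right] at h4
  linarith

end InexactOracle

/-! ### Iteration counts for the inner subproblem -/

section InnerMethod

theorem Standing.innerLipschitz_pos (hP : P.Standing Lf) {ρ : ℝ} (hρ : 0 < ρ) :
    0 < Lf + ρ * ‖P.G‖ ^ 2 := add_pos_of_pos_of_nonneg hP.Lf_pos (by positivity)

theorem innerSolve_point_mem (hP : P.Standing Lf) (ρ : ℝ) (x : EuclideanSpace ℝ (Fin m))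
    {v : EuclideanSpace ℝ (Fin n)} (hv : v ∈ P.U) (N : ℕ) :
    (P.innerSolve Lf ρ x v N).point ∈ P.U :=
  nesterov_point_mem _ _ hP.closed_U hv N

/-- Accuracy of Nesterov's method on the inner subproblem. -/
theorem innerSolve_accurate (hP : P.Standing Lf) {ρ : ℝ} (hρ : 0 < ρ)
    (x : EuclideanSpace ℝ (Fin m)) {v : EuclideanSpace ℝ (Fin n)} (hv : v ∈ P.U) {N : ℕ}
    (hN : 1 ≤ N) {r δ : ℝ} (hr : ∀ u ∈ P.U, ‖v - u‖ ≤ r)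
    (h : 2 * (Lf + ρ * ‖P.G‖ ^ 2) * r ^ 2 ≤ δ * ((N : ℝ) + 1) ^ 2) :
    P.augLag ρ (P.innerSolve Lf ρ x v N).point x - P.augDual ρ x ≤ δ := by
  have hL := hP.innerLipschitz_pos hρ
  rw [sub_le_comm]
  refine le_augDual hP fun u hu => ?_
  have h1 := nesterov_rate hL hP.closed_U hP.convex_U (augLag_gradient_le hP hρ.le x)
    (augLag_le_gradient hP hρ.le x) hv hu hN
  have h2 : 2 * (Lf + ρ * ‖P.G‖ ^ 2) * ‖v - u‖ ^ 2 / ((N : ℝ) + 1) ^ 2 ≤ δ := by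
    rw [div_le_iff₀ (by positivity)]
    refine le_trans ?_ h
    have := hr u hu
    gcongr
  simp only [innerSolve]
  linarith

theorem Standing.norm_sub_le_diam (hP : P.Standing Lf) {u v : EuclideanSpace ℝ (Fin n)}
    (hv : v ∈ P.U) (hu : u ∈ P.U) : ‖v - u‖ ≤ Metric.diam P.U := by
  rw [← dist_eq_norm]
  exact Metric.dist_le_diam_of_mem hP.bounded_U hv hu

/-- The rate involves `N + 1`, so rounding down is enough; the maximum with 1 is there because the
rate needs at least one step. -/
theorem one_le_and_lt_of_max_floor_le {b : ℝ} {N : ℕ} (h : max 1 ⌊b⌋₊ ≤ N) :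
    1 ≤ N ∧ b < (N : ℝ) + 1 := by
  refine ⟨(le_max_left _ _).trans h, (Nat.lt_floor_add_one b).trans_le ?_⟩
  have : ⌊b⌋₊ ≤ N := (le_max_right _ _).trans h
  gcongr

theorem ifalDelta_pos {ε : ℝ} (hε : 0 < ε) (k : ℕ) : 0 < ifalDelta ε k := by
  unfold ifalDelta
  positivity

theorem innerSolve_accurate_of_innerBound_le (hP : P.Standing Lf) {ρ ε : ℝ} (hρ : 0 < ρ)
    (hε : 0 < ε) (x : EuclideanSpace ℝ (Fin m)) {v : EuclideanSpace ℝ (Fin n)} (hv : v ∈ P.U)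
    {k N : ℕ} (hN : P.innerBound Lf ρ ε k ≤ N) :
    P.augLag ρ (P.innerSolve Lf ρ x v N).point x - P.augDual ρ x ≤ ifalDelta ε k := by
  obtain ⟨h1, h2⟩ := one_le_and_lt_of_max_floor_le hN
  have hL := hP.innerLipschitz_pos hρ
  have hδ := ifalDelta_pos hε k
  refine innerSolve_accurate hP hρ x hv h1 (fun u hu => hP.norm_sub_le_diam hv hu) ?_
  have h3 : (2 * Metric.diam P.U * √((Lf + ρ * ‖P.G‖ ^ 2) / ifalDelta ε k)) ^ 2 ≤
      ((N : ℝ) + 1) ^ 2 := by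
    have : 0 ≤ Metric.diam P.U := Metric.diam_nonneg
    gcongr
  rw [mul_pow, Real.sq_sqrt (by positivity), mul_div_assoc', div_le_iff₀ hδ] at h3
  have h4 : 0 ≤ (Lf + ρ * ‖P.G‖ ^ 2) * Metric.diam P.U ^ 2 := by positivity
  linarith

theorem rhoOpt_pos {X ε : ℝ} (hX : 0 < X) (hε : 0 < ε) : 0 < rhoOpt X ε := by
  unfold rhoOpt
  positivity

theorem projEstimate_nonneg (P : LinProblem n m) (Lf : ℝ) {X ε : ℝ} (hX : 0 < X) (hε : 0 < ε) :
    0 ≤ P.projEstimate Lf X ε := by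
  have : 0 ≤ Metric.diam P.U := Metric.diam_nonneg
  unfold projEstimate
  positivity

/-- With `δ₀ = ε / 6`, dividing the left side by `δ₀` gives `p² + q²`, where `p` and `q` are the two
terms of `B`; then `p² + q² ≤ (p + q)²`. -/
theorem mul_diam_sq_le_mul_projEstimate_sq (hP : P.Standing Lf) {X ε : ℝ} (hX : 0 < X)
    (hε : 0 < ε) : (Lf + rhoOpt X ε * ‖P.G‖ ^ 2) * Metric.diam P.U ^ 2 ≤
      ifalDelta ε 0 * P.projEstimate Lf X ε ^ 2 := by
  have hL := hP.Lf_pos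
  have hD : 0 ≤ Metric.diam P.U := Metric.diam_nonneg
  have h1 : √(6 * Lf * Metric.diam P.U ^ 2 / ε) ^ 2 = 6 * Lf * Metric.diam P.U ^ 2 / ε :=
    Real.sq_sqrt (by positivity)
  have h2 : (4 * √6 * Metric.diam P.U * ‖P.G‖ * X / ε) ^ 2 =
      96 * (Metric.diam P.U * ‖P.G‖ * X / ε) ^ 2 := by
    have : √6 ^ 2 = (6 : ℝ) := Real.sq_sqrt (by norm_num)
    calc _ = 16 * √6 ^ 2 * (Metric.diam P.U * ‖P.G‖ * X / ε) ^ 2 := by ring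
      _ = _ := by rw [this]; norm_num
  have h3 : 0 ≤ √(6 * Lf * Metric.diam P.U ^ 2 / ε) *
      (4 * √6 * Metric.diam P.U * ‖P.G‖ * X / ε) := by positivity
  calc (Lf + rhoOpt X ε * ‖P.G‖ ^ 2) * Metric.diam P.U ^ 2
      = ifalDelta ε 0 * (6 * Lf * Metric.diam P.U ^ 2 / ε +
        96 * (Metric.diam P.U * ‖P.G‖ * X / ε) ^ 2) := by
        unfold ifalDelta rhoOpt
        push_cast
        field_simp
        ring
    _ ≤ _ := by
        refine mul_le_mul_of_nonneg_left ?_ (ifalDelta_pos hε 0).le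
        unfold projEstimate
        rw [add_sq, h1, h2]
        linarith

/-- For `ρ = 16 X² / ε`, if `max 1 ⌊c B⌋ ≤ N` then `N` inner iterations from a starting point
within `r` of every point of `U` have accuracy `a δ₀`, provided that `2 r² ≤ a c² D²`. -/
theorem innerSolve_rhoOpt_accurate (hP : P.Standing Lf) {X ε : ℝ} (hX : 0 < X)
    (hε : 0 < ε) (x : EuclideanSpace ℝ (Fin m)) {v : EuclideanSpace ℝ (Fin n)} (hv : v ∈ P.U)
    {N : ℕ} {c a r : ℝ} (hc : 0 ≤ c) (ha : 0 ≤ a) (hr : ∀ u ∈ P.U, ‖v - u‖ ≤ r)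
    (hrc : 2 * r ^ 2 ≤ a * c ^ 2 * Metric.diam P.U ^ 2)
    (hN : max 1 ⌊c * P.projEstimate Lf X ε⌋₊ ≤ N) :
    P.augLag (rhoOpt X ε) (P.innerSolve Lf (rhoOpt X ε) x v N).point x -
      P.augDual (rhoOpt X ε) x ≤ a * ifalDelta ε 0 := by
  obtain ⟨h1, h2⟩ := one_le_and_lt_of_max_floor_le hN
  have hρ := rhoOpt_pos hX hε
  have hL := hP.innerLipschitz_pos hρ
  have hδ := ifalDelta_pos hε 0
  refine innerSolve_accurate hP hρ x hv h1 hr ?_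
  have hB := projEstimate_nonneg P Lf hX hε
  calc 2 * (Lf + rhoOpt X ε * ‖P.G‖ ^ 2) * r ^ 2
      = (Lf + rhoOpt X ε * ‖P.G‖ ^ 2) * (2 * r ^ 2) := by ring
    _ ≤ (Lf + rhoOpt X ε * ‖P.G‖ ^ 2) * (a * c ^ 2 * Metric.diam P.U ^ 2) := by gcongr
    _ = a * c ^ 2 * ((Lf + rhoOpt X ε * ‖P.G‖ ^ 2) * Metric.diam P.U ^ 2) := by ring
    _ ≤ a * c ^ 2 * (ifalDelta ε 0 * P.projEstimate Lf X ε ^ 2) :=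
        mul_le_mul_of_nonneg_left (mul_diam_sq_le_mul_projEstimate_sq hP hX hε) (by positivity)
    _ = a * ifalDelta ε 0 * (c * P.projEstimate Lf X ε) ^ 2 := by ring
    _ ≤ a * ifalDelta ε 0 * ((N : ℝ) + 1) ^ 2 := by gcongr

end InnerMethod

/-! ### Decrease of the smoothed gap and the passage to `ε`-optimality -/

section OuterMethod

/-- One outer iteration contracts the smoothed duality gap up to the inner error. -/
theorem smoothedGap_step (hP : P.Standing Lf) {ρ μ τ δ θ : ℝ} (hρ : 0 < ρ) (hμ : 0 < μ)
    (hτ0 : 0 ≤ τ) (hτ1 : τ < 1) (hθ0 : 0 < θ) (hθ1 : θ < 1)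
    (hcond : τ ^ 2 / ((1 - τ) * μ) ≤ ρ * (τ + 2 - 1 / θ))
    {u w : EuclideanSpace ℝ (Fin n)} {x y : EuclideanSpace ℝ (Fin m)} (hw : w ∈ P.U)
    (hy : y = (1 - τ) • x + (τ / μ) • (P.G u + P.g))
    (h : P.augLag ρ w y - P.augDual ρ y ≤ δ) :
    P.smoothedGap ρ ((1 - τ) * μ) ((1 - τ) • u + τ • w) (y + ρ • (P.G w + P.g)) ≤
      (1 - τ) * P.smoothedGap ρ μ u x + δ / (1 - θ) := by
  have hτ : 0 < 1 - τ := sub_pos.2 hτ1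
  have h1 := augDual_ge_of_approx hP hρ hw h hθ0 hθ1 (y + ρ • (P.G w + P.g))
  have h2 := mul_le_mul_of_nonneg_left (augDual_le hP ρ x hw) hτ.le
  have hf := hP.convex_f.2 (Set.mem_univ u) (Set.mem_univ w) hτ.le hτ0 (by ring)
  have hA : P.G ((1 - τ) • u + τ • w) + P.g = (1 - τ) • (P.G u + P.g) + τ • (P.G w + P.g) := by
    rw [map_add, map_smul, map_smul]; module
  simp only [smul_eq_mul] at hf
  simp only [smoothedGap, smoothedPrimal, hA]
  rw [add_sub_cancel_left] at h1
  set D := P.augDual ρ (y + ρ • (P.G w + P.g))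
  simp only [augLag, hy] at h1 h2
  generalize P.G u + P.g = a at *
  generalize P.G w + P.g = b at *
  -- The cross term `(τ / μ) ⟨a, b⟩` also occurs in `augLag` at `y`, by the choice of `y`, and
  -- cancels. Only multiples of `‖b‖²` remain, and `hcond` compares them.
  have h3 : 1 / (2 * ((1 - τ) * μ)) * ‖(1 - τ) • a + τ • b‖ ^ 2 =
      (1 - τ) * (1 / (2 * μ) * ‖a‖ ^ 2) + τ / μ * inner ℝ a b +
        1 / 2 * (τ ^ 2 / ((1 - τ) * μ)) * ‖b‖ ^ 2 := by
    rw [norm_add_sq_real, real_inner_smul_left, real_inner_smul_right, norm_smul, norm_smul,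
      mul_pow, mul_pow, Real.norm_eq_abs, Real.norm_eq_abs, sq_abs, sq_abs]
    field_simp
  have h4 := mul_le_mul_of_nonneg_right hcond (sq_nonneg ‖b‖)
  have h5 : 1 / (2 * ρ * θ) * ‖ρ • b‖ ^ 2 = ρ / 2 * (1 / θ) * ‖b‖ ^ 2 := by
    rw [norm_smul, mul_pow, Real.norm_eq_abs, sq_abs]
    field_simp
  rw [h5, real_inner_smul_left, inner_add_left, real_inner_smul_left, real_inner_smul_left,
    real_inner_self_eq_norm_sq] at h1
  rw [h3]
  linarith

/-- In the second alternative, the minorant at the multiplier 0 with `θ = 1/2` is evaluated at `x⁰`.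
The multiples of `ρ ‖Gu⁰ + g‖²` in the gap sum to `1/8 - 1/2 - 1/4 + 1/16 < 0`, leaving `2 δ₀`. -/
theorem smoothedGap_le_of_isInitialPair (hP : P.Standing Lf) {ρ ε : ℝ} (hρ : 0 < ρ) (hε : 0 < ε)
    {u : EuclideanSpace ℝ (Fin n)} {x : EuclideanSpace ℝ (Fin m)} (h : P.IsInitialPair ρ ε u x) :
    P.smoothedGap ρ (4 / ρ) u x ≤ 2 * ifalDelta ε 0 := by
  have hδ := ifalDelta_pos hε 0
  obtain ⟨hu, h | ⟨h, rfl⟩⟩ := h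
  · linarith
  · have h1 := augDual_ge_of_approx hP hρ hu h (θ := 1 / 2) (by norm_num) (by norm_num)
      ((1 / (4 / ρ)) • (P.G u + P.g))
    rw [sub_zero, real_inner_smul_left, real_inner_self_eq_norm_sq, norm_smul, mul_pow,
      Real.norm_eq_abs, sq_abs] at h1
    simp only [augLag, inner_zero_left] at h1
    simp only [smoothedGap, smoothedPrimal]
    set D := P.augDual ρ ((1 / (4 / ρ)) • (P.G u + P.g))
    generalize P.G u + P.g = a at *
    have h2 : 1 / (2 * ρ * (1 / 2)) * ((1 / (4 / ρ)) ^ 2 * ‖a‖ ^ 2) = ρ / 16 * ‖a‖ ^ 2 := by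
      field_simp
      ring
    have h3 : 1 / (2 * (4 / ρ)) * ‖a‖ ^ 2 = ρ / 8 * ‖a‖ ^ 2 := by
      field_simp
      ring
    have h4 : 1 / (4 / ρ) * ‖a‖ ^ 2 = ρ / 4 * ‖a‖ ^ 2 := by rw [one_div_div]
    have h5 : ifalDelta ε 0 / (1 - 1 / 2) = 2 * ifalDelta ε 0 := by ring
    rw [h2, h4, h5] at h1
    rw [h3]
    have h6 : 0 ≤ ρ * ‖a‖ ^ 2 := by positivity
    linarith

theorem isEpsOptimal_of_smoothedGap_le (hP : P.Standing Lf) {xs : EuclideanSpace ℝ (Fin m)}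
    (hxs : P.IsOptimalMultiplier xs) (hxs2 : 2 ≤ ‖xs‖) {ρ μ ε : ℝ} (hμ : 0 < μ) (hε : 0 < ε)
    (hμε : μ * (4 * ‖xs‖ ^ 2) ≤ ε) {u : EuclideanSpace ℝ (Fin n)}
    {x : EuclideanSpace ℝ (Fin m)} (hu : u ∈ P.U) (h : P.smoothedGap ρ μ u x ≤ ε) :
    P.IsEpsOptimal ε u := by
  have h1 := augDual_le_optVal hP ρ x
  have h2 := optVal_le_lagrangian hP hxs hu
  have h3 := real_inner_le_norm xs (P.G u + P.g)
  simp only [smoothedGap, smoothedPrimal] at h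
  simp only [lagrangian] at h2
  refine ⟨hu, ?_, ?_⟩
  · have : 0 ≤ 1 / (2 * μ) * ‖P.G u + P.g‖ ^ 2 := by positivity
    linarith
  · by_contra! hlt
    generalize P.G u + P.g = a at *
    -- If `‖a‖ > ε`, then `4 μ ‖xs‖² < ‖a‖`, so the penalty exceeds the multiplier term `‖xs‖ ‖a‖`
    -- by at least `2 ‖a‖ > ε`; this is where `‖xs‖ ≥ 2` enters.
    have h4 : 2 * ‖xs‖ ^ 2 * ‖a‖ ≤ 1 / (2 * μ) * ‖a‖ ^ 2 := by
      rw [div_mul_eq_mul_div, one_mul, le_div_iff₀ (by positivity)]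
      nlinarith [norm_nonneg a]
    have h5 : ‖xs‖ + 2 ≤ 2 * ‖xs‖ ^ 2 := by nlinarith
    have h6 := mul_le_mul_of_nonneg_right h5 (norm_nonneg a)
    linarith

theorem ifal_projections (P : LinProblem n m) (Lf ρ : ℝ) (u₀ : EuclideanSpace ℝ (Fin n))
    (x₀ : EuclideanSpace ℝ (Fin m)) (v : ℕ → EuclideanSpace ℝ (Fin n)) (ν : ℕ → ℕ) (K : ℕ) :
    (P.ifal Lf ρ u₀ x₀ v ν K).projections = ∑ k ∈ Finset.range K, ν k := by
  induction K with
  | zero => rfl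
  | succ K ih =>
    rw [Finset.sum_range_succ, ← ih]
    simp [ifal, ifalStep, innerSolve, nesterov_projections]

/-- The factors `1 - τ_k = (k + 1) / (k + 3)` telescope. -/
theorem ifal_mu (P : LinProblem n m) (Lf ρ : ℝ) (u₀ : EuclideanSpace ℝ (Fin n))
    (x₀ : EuclideanSpace ℝ (Fin m)) (v : ℕ → EuclideanSpace ℝ (Fin n)) (ν : ℕ → ℕ) (k : ℕ) :
    (P.ifal Lf ρ u₀ x₀ v ν k).mu = 8 / (ρ * (((k : ℝ) + 1) * ((k : ℝ) + 2))) := by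
  induction k with
  | zero =>
    simp only [ifal]
    push_cast
    rw [← div_div]
    ring
  | succ k ih =>
    simp only [ifal, ifalStep, ih, ifalTau]
    push_cast
    rw [← div_div 8 ρ, ← div_div 8 ρ]
    generalize 8 / ρ = c
    field_simp
    ring

theorem ifalTau_pos (k : ℕ) : 0 < ifalTau k := by
  unfold ifalTau
  positivity

theorem ifalTau_lt_one (k : ℕ) : ifalTau k < 1 := by
  unfold ifalTau
  rw [div_lt_one (by positivity)]
  have : (0 : ℝ) ≤ k := k.cast_nonneg
  linarith

theorem ifal_u_mem (hP : P.Standing Lf) (ρ : ℝ) {u₀ : EuclideanSpace ℝ (Fin n)}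
    (hu₀ : u₀ ∈ P.U) (x₀ : EuclideanSpace ℝ (Fin m)) {v : ℕ → EuclideanSpace ℝ (Fin n)}
    (hv : ∀ k, v k ∈ P.U) (ν : ℕ → ℕ) (k : ℕ) : (P.ifal Lf ρ u₀ x₀ v ν k).u ∈ P.U := by
  induction k with
  | zero => exact hu₀
  | succ k ih =>
    exact hP.convex_U ih (innerSolve_point_mem hP ρ _ (hv k) (ν k))
      (sub_nonneg.2 (ifalTau_lt_one k).le) (ifalTau_pos k).le (by ring)

/-- Change of the smoothed duality gap in one outer iteration of IFAL. -/
theorem ifal_smoothedGap_succ_le (hP : P.Standing Lf) {ρ δ θ : ℝ} (hρ : 0 < ρ)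
    (u₀ : EuclideanSpace ℝ (Fin n)) (x₀ : EuclideanSpace ℝ (Fin m))
    {v : ℕ → EuclideanSpace ℝ (Fin n)} (hv : ∀ k, v k ∈ P.U) (ν : ℕ → ℕ) (k : ℕ)
    (hθ0 : 0 < θ) (hθ1 : θ < 1) (hcond : ((k : ℝ) + 2) / (2 * ((k : ℝ) + 3)) ≤
      ifalTau k + 2 - 1 / θ)
    (h : P.augLag ρ (P.innerSolve Lf ρ (P.xhat k (P.ifal Lf ρ u₀ x₀ v ν k)) (v k) (ν k)).point
        (P.xhat k (P.ifal Lf ρ u₀ x₀ v ν k)) -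
      P.augDual ρ (P.xhat k (P.ifal Lf ρ u₀ x₀ v ν k)) ≤ δ) :
    P.smoothedGap ρ (P.ifal Lf ρ u₀ x₀ v ν (k + 1)).mu (P.ifal Lf ρ u₀ x₀ v ν (k + 1)).u
        (P.ifal Lf ρ u₀ x₀ v ν (k + 1)).x ≤
      (1 - ifalTau k) * P.smoothedGap ρ (P.ifal Lf ρ u₀ x₀ v ν k).mu
        (P.ifal Lf ρ u₀ x₀ v ν k).u (P.ifal Lf ρ u₀ x₀ v ν k).x + δ / (1 - θ) := by
  have hmu := ifal_mu P Lf ρ u₀ x₀ v ν k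
  refine smoothedGap_step hP hρ (by rw [hmu]; positivity) (ifalTau_pos k).le (ifalTau_lt_one k)
    hθ0 hθ1 ?_ (innerSolve_point_mem hP ρ _ (hv k) (ν k)) rfl h
  refine le_trans (le_of_eq ?_) (mul_le_mul_of_nonneg_left hcond hρ.le)
  have e : 1 - ifalTau k = ((k : ℝ) + 1) / ((k : ℝ) + 3) := by
    unfold ifalTau
    field_simp
    ring
  rw [e, hmu, ifalTau]
  field_simp
  norm_num

theorem ifal_smoothedGap_le (hP : P.Standing Lf) {ρ ε : ℝ} (hρ : 0 < ρ) (hε : 0 < ε)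
    {u₀ : EuclideanSpace ℝ (Fin n)} {x₀ : EuclideanSpace ℝ (Fin m)}
    (h₀ : P.IsInitialPair ρ ε u₀ x₀) {v : ℕ → EuclideanSpace ℝ (Fin n)} (hv : ∀ k, v k ∈ P.U)
    (ν : ℕ → ℕ) (K : ℕ) (hacc : ∀ k < K, P.CallAccurate Lf ρ ε u₀ x₀ v ν k (ν k)) :
    P.smoothedGap ρ (P.ifal Lf ρ u₀ x₀ v ν K).mu (P.ifal Lf ρ u₀ x₀ v ν K).u
        (P.ifal Lf ρ u₀ x₀ v ν K).x ≤ 3 / 4 * ε := by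
  induction K with
  | zero =>
    refine (smoothedGap_le_of_isInitialPair hP hρ hε h₀).trans ?_
    unfold ifalDelta
    push_cast
    linarith
  | succ k ih =>
    have ih' := ih fun j hj => hacc j (hj.trans k.lt_succ_self)
    -- Here `2 - 1/θ = 1/2` dominates the left side of the condition for every `k`. The error `3
    -- δ_k` equals `τ_k · 3ε/4`, so `3ε/4` is a fixed point of the recursion.
    have h := ifal_smoothedGap_succ_le hP hρ u₀ x₀ hv ν k (θ := 2 / 3) (by norm_num)
      (by norm_num) ?_ (hacc k k.lt_succ_self)
    · refine h.trans ?_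
      have h1 := mul_le_mul_of_nonneg_left ih' (sub_nonneg.2 (ifalTau_lt_one k).le)
      refine (add_le_add_left h1 _).trans (le_of_eq ?_)
      unfold ifalTau ifalDelta
      field_simp
      ring
    · have h1 := ifalTau_pos k
      have h2 : ((k : ℝ) + 2) / (2 * ((k : ℝ) + 3)) ≤ 1 / 2 := by
        rw [div_le_iff₀ (by positivity)]
        linarith
      linarith

theorem ifal_one_smoothedGap_le (hP : P.Standing Lf) {ρ ε : ℝ} (hρ : 0 < ρ) (hε : 0 < ε)
    {u₀ : EuclideanSpace ℝ (Fin n)} {x₀ : EuclideanSpace ℝ (Fin m)}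
    (h₀ : P.IsInitialPair ρ ε u₀ x₀) {v : ℕ → EuclideanSpace ℝ (Fin n)} (hv : ∀ k, v k ∈ P.U)
    (ν : ℕ → ℕ)
    (hacc : P.augLag ρ (P.innerSolve Lf ρ (P.xhat 0 (P.ifal Lf ρ u₀ x₀ v ν 0)) (v 0) (ν 0)).point
        (P.xhat 0 (P.ifal Lf ρ u₀ x₀ v ν 0)) -
      P.augDual ρ (P.xhat 0 (P.ifal Lf ρ u₀ x₀ v ν 0)) ≤ 2 * ifalDelta ε 0) :
    P.smoothedGap ρ (P.ifal Lf ρ u₀ x₀ v ν 1).mu (P.ifal Lf ρ u₀ x₀ v ν 1).u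
        (P.ifal Lf ρ u₀ x₀ v ν 1).x ≤ ε := by
  -- At `k = 0` the condition reads `1/3 ≤ 2/3`. The new gap is at most `(1/3)(ε/3) + 4 δ₀ = 7ε/9`.
  have h := ifal_smoothedGap_succ_le hP hρ u₀ x₀ hv ν 0 (θ := 1 / 2) (by norm_num)
    (by norm_num) (by norm_num [ifalTau]) hacc
  refine h.trans ?_
  have h1 := smoothedGap_le_of_isInitialPair hP hρ hε h₀
  have h2 : (P.ifal Lf ρ u₀ x₀ v ν 0) = { u := u₀, x := x₀, mu := 4 / ρ, projections := 0 } := rfl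
  rw [h2]
  have e1 : ifalTau 0 = 2 / 3 := by norm_num [ifalTau]
  have e2 : ifalDelta ε 0 = ε / 6 := by norm_num [ifalDelta]
  have e3 : 2 * (ε / 6) / (1 - 1 / 2) = 2 / 3 * ε := by ring
  rw [e2] at h1
  rw [e1, e2, e3]
  linarith

theorem ifal_mu_mul_le {X ρ ε : ℝ} (hρ : 0 < ρ) {K : ℕ}
    (hK : 32 * X ^ 2 ≤ (((K : ℝ) + 1) * ((K : ℝ) + 2)) * (ρ * ε)) :
    8 / (ρ * (((K : ℝ) + 1) * ((K : ℝ) + 2))) * (4 * X ^ 2) ≤ ε := by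
  rw [div_mul_eq_mul_div, div_le_iff₀ (by positivity)]
  linarith

/-- This is the requirement `4 μ_N X² ≤ ε`. One step at `ρ ≥ ρ₀` gives `6 · 16 X²`; otherwise `N² ρ
ε ≥ (4√2 X)² = 32 X²`. -/
theorem sq_le_outerBound {X ρ ε : ℝ} (hX : 0 < X) (hρ : 0 < ρ) (hε : 0 < ε) :
    32 * X ^ 2 ≤ (((outerBound X ρ ε : ℝ) + 1) * ((outerBound X ρ ε : ℝ) + 2)) * (ρ * ε) := by
  unfold outerBound
  split_ifs with h
  · rw [rhoOpt, div_le_iff₀ hε] at h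
    push_cast
    linarith [sq_nonneg X]
  · have h1 := Nat.le_ceil (4 * √2 * X / √(ρ * ε))
    set N : ℝ := (⌈4 * √2 * X / √(ρ * ε)⌉₊ : ℝ)
    have h0 : 0 ≤ N := Nat.cast_nonneg _
    have h2 : (4 * √2 * X / √(ρ * ε)) ^ 2 ≤ N ^ 2 := by gcongr
    rw [div_pow, mul_pow, mul_pow, Real.sq_sqrt (by norm_num), Real.sq_sqrt (by positivity),
      div_le_iff₀ (by positivity)] at h2
    have h3 : 0 < ρ * ε := by positivity
    nlinarith

end OuterMethod

/-! ### Comparison of total costs, and their order in `1 / ε` -/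

section TotalBound

theorem le_two_mul_max_one_floor (a : ℝ) : a ≤ 2 * ((max 1 ⌊a⌋₊ : ℕ) : ℝ) := by
  obtain ⟨h1, h2⟩ := one_le_and_lt_of_max_floor_le (le_refl (max 1 ⌊a⌋₊))
  have : (1 : ℝ) ≤ ((max 1 ⌊a⌋₊ : ℕ) : ℝ) := by exact_mod_cast h1
  linarith

theorem totalBound_rhoOpt (P : LinProblem n m) (Lf X ε : ℝ) :
    P.totalBound Lf X (rhoOpt X ε) ε = P.innerBound Lf (rhoOpt X ε) ε 0 := by
  simp [totalBound, outerBound]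

theorem totalBound_rhoOpt_le (hP : P.Standing Lf) {X ρ ε : ℝ} (hX : 0 < X) (hρ : 0 < ρ)
    (hε : 0 < ε) :
    P.totalBound Lf X (rhoOpt X ε) ε ≤ 2 * P.totalBound Lf X ρ ε := by
  rw [totalBound_rhoOpt]
  have hD : 0 ≤ Metric.diam P.U := Metric.diam_nonneg
  have hL := hP.innerLipschitz_pos hρ
  have hLf := hP.Lf_pos
  have hδ := ifalDelta_pos hε
  by_cases hle : rhoOpt X ε ≤ ρ
  · have h : P.totalBound Lf X ρ ε = P.innerBound Lf ρ ε 0 := by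
      simp [totalBound, outerBound, hle]
    rw [h]
    refine le_trans ?_ (Nat.le_mul_of_pos_left _ two_pos)
    unfold innerBound
    have := (hδ 0).le
    gcongr
  · push Not at hle
    have hN : outerBound X ρ ε = ⌈4 * √2 * X / √(ρ * ε)⌉₊ := by
      simp [outerBound, hle]
    set N := outerBound X ρ ε with hNdef
    have hNreal : 4 * √2 * X / √(ρ * ε) ≤ (N : ℝ) := by rw [hN]; exact Nat.le_ceil _
    have hN1 : 1 ≤ N := by
      rw [hN]
      exact Nat.ceil_pos.2 (by positivity)
    -- Since `δ_k ≤ δ₀`, each call costs at least half of the unrounded cost of call 0; the half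
    -- pays for the floor.
    have hterm : ∀ k ∈ Finset.range N,
        2 * Metric.diam P.U * √((Lf + ρ * ‖P.G‖ ^ 2) / ifalDelta ε 0) ≤
          2 * (P.innerBound Lf ρ ε k : ℝ) := fun k _ => by
      refine le_trans ?_ (le_two_mul_max_one_floor _)
      have h1 := hδ k
      have : ifalDelta ε k ≤ ifalDelta ε 0 := by
        unfold ifalDelta
        gcongr
        exact k.zero_le
      gcongr
    have hsum := Finset.sum_le_sum hterm
    rw [Finset.sum_const, Finset.card_range, nsmul_eq_mul, ← Finset.mul_sum] at hsum
    have hT : (P.totalBound Lf X ρ ε : ℝ) = ∑ k ∈ Finset.range N, (P.innerBound Lf ρ ε k : ℝ) := by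
      simp [totalBound, ← hNdef]
    rw [← hT] at hsum
    have hb : 2 * Metric.diam P.U * √((Lf + rhoOpt X ε * ‖P.G‖ ^ 2) / ifalDelta ε 0) ≤
        N * (2 * Metric.diam P.U * √((Lf + ρ * ‖P.G‖ ^ 2) / ifalDelta ε 0)) := by
      rw [mul_left_comm]
      refine mul_le_mul_of_nonneg_left ?_ (by positivity)
      have h0 := hδ 0
      refine Real.sqrt_le_iff.2 ⟨by positivity, ?_⟩
      rw [mul_pow, Real.sq_sqrt (by positivity), ← mul_div_assoc]
      refine div_le_div_of_nonneg_right ?_ h0.le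
      -- In fact `N² ρ ≥ 32 X² / ε = 2 ρ₀`. With `N ≥ 1` for the `Lf` part, the factor `N` can be
      -- moved inside the square root.
      have h1 : rhoOpt X ε ≤ (N : ℝ) ^ 2 * ρ := by
        have h2 : (4 * √2 * X / √(ρ * ε)) ^ 2 ≤ (N : ℝ) ^ 2 := by gcongr
        rw [div_pow, mul_pow, mul_pow, Real.sq_sqrt (by norm_num), Real.sq_sqrt (by positivity),
          div_le_iff₀ (by positivity)] at h2
        rw [rhoOpt, div_le_iff₀ hε]
        nlinarith [sq_nonneg X]
      have h3 : (1 : ℝ) ≤ (N : ℝ) ^ 2 := one_le_pow₀ (by exact_mod_cast hN1)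
      nlinarith [sq_nonneg ‖P.G‖]
    have hpos : 1 ≤ P.totalBound Lf X ρ ε := by
      unfold totalBound
      rw [← hNdef]
      calc 1 ≤ P.innerBound Lf ρ ε 0 := le_max_left _ _
        _ ≤ _ := Finset.single_le_sum (f := fun k => P.innerBound Lf ρ ε k)
          (fun _ _ => Nat.zero_le _) (Finset.mem_range.2 hN1)
    refine max_le (by omega) (Nat.floor_le_of_le ?_)
    push_cast
    linarith

theorem projEstimate_isBigO (P : LinProblem n m) (Lf : ℝ) {X : ℝ} (hX : 0 ≤ X) :
    (fun ε : ℝ => ((max 1 ⌊2 * P.projEstimate Lf X ε⌋₊ : ℕ) : ℝ))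
      =O[nhdsWithin 0 (Set.Ioi 0)] fun ε : ℝ => 1 / ε := by
  refine Asymptotics.IsBigO.of_bound (1 + 2 * (√(6 * Lf * Metric.diam P.U ^ 2) +
    4 * √6 * Metric.diam P.U * ‖P.G‖ * X)) ?_
  filter_upwards [Ioo_mem_nhdsGT (zero_lt_one' ℝ)] with ε hε
  obtain ⟨h0, h1⟩ := hε
  have hD : 0 ≤ Metric.diam P.U := Metric.diam_nonneg
  have hB : 0 ≤ P.projEstimate Lf X ε := by unfold projEstimate; positivity
  -- For `ε < 1` one has `ε ≤ √ε`, so the square root term is also of order `1 / ε`.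
  have hs : √(6 * Lf * Metric.diam P.U ^ 2 / ε) ≤ √(6 * Lf * Metric.diam P.U ^ 2) / ε := by
    rw [Real.sqrt_div' _ h0.le]
    gcongr
    exact Real.le_sqrt_of_sq_le (by nlinarith)
  rw [Real.norm_of_nonneg (Nat.cast_nonneg _), Real.norm_of_nonneg (by positivity), Nat.cast_max,
    Nat.cast_one, mul_one_div]
  have h2 : (1 : ℝ) ≤ 1 / ε := (one_le_div h0).2 h1.le
  calc max (1 : ℝ) (⌊2 * P.projEstimate Lf X ε⌋₊ : ℝ) ≤ 1 + 2 * P.projEstimate Lf X ε :=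
        max_le (by linarith) ((Nat.floor_le (by positivity)).trans (by linarith))
    _ ≤ 1 / ε + 2 * (√(6 * Lf * Metric.diam P.U ^ 2) / ε +
          4 * √6 * Metric.diam P.U * ‖P.G‖ * X / ε) := by
        unfold projEstimate
        gcongr
    _ = _ := by ring

end TotalBound

end LinProblem

namespace LinProblem

variable {n m : ℕ} {P : LinProblem n m} {Lf : ℝ}

/-! ### From gap bounds to `ε`-optimality of the iterates -/

section EpsOptimality

variable {xs : EuclideanSpace ℝ (Fin m)} {ε : ℝ} {u₀ : EuclideanSpace ℝ (Fin n)}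
  {x₀ : EuclideanSpace ℝ (Fin m)} {v : ℕ → EuclideanSpace ℝ (Fin n)}

theorem ifal_isEpsOptimal_of_smoothedGap_le (hP : P.Standing Lf) (hxs : P.IsOptimalMultiplier xs)
    (hxs2 : 2 ≤ ‖xs‖) {ρ : ℝ} (hρ : 0 < ρ) (hε : 0 < ε) (h₀ : P.IsInitialPair ρ ε u₀ x₀)
    (hv : ∀ k, v k ∈ P.U) (ν : ℕ → ℕ)
    (h : P.smoothedGap ρ (P.ifal Lf ρ u₀ x₀ v ν (outerBound ‖xs‖ ρ ε)).mu
      (P.ifal Lf ρ u₀ x₀ v ν (outerBound ‖xs‖ ρ ε)).u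
      (P.ifal Lf ρ u₀ x₀ v ν (outerBound ‖xs‖ ρ ε)).x ≤ ε) :
    P.IsEpsOptimal ε (P.ifal Lf ρ u₀ x₀ v ν (outerBound ‖xs‖ ρ ε)).u := by
  have hmu := ifal_mu P Lf ρ u₀ x₀ v ν (outerBound ‖xs‖ ρ ε)
  refine isEpsOptimal_of_smoothedGap_le hP hxs hxs2 (by rw [hmu]; positivity) hε ?_
    (ifal_u_mem hP ρ h₀.1 x₀ hv ν _) h
  rw [hmu]
  exact ifal_mu_mul_le hρ (sq_le_outerBound (by linarith) hρ hε)

/-- If the inner calls `k < N(ρ)` are accurate, then `u^{N(ρ)}` is `ε`-optimal. -/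
theorem ifal_outerBound_isEpsOptimal (hP : P.Standing Lf) (hxs : P.IsOptimalMultiplier xs)
    (hxs2 : 2 ≤ ‖xs‖) {ρ : ℝ} (hρ : 0 < ρ) (hε : 0 < ε) (h₀ : P.IsInitialPair ρ ε u₀ x₀)
    (hv : ∀ k, v k ∈ P.U) (ν : ℕ → ℕ)
    (hacc : ∀ k < outerBound ‖xs‖ ρ ε, P.CallAccurate Lf ρ ε u₀ x₀ v ν k (ν k)) :
    P.IsEpsOptimal ε (P.ifal Lf ρ u₀ x₀ v ν (outerBound ‖xs‖ ρ ε)).u := by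
  have h := ifal_smoothedGap_le hP hρ hε h₀ hv ν (outerBound ‖xs‖ ρ ε) hacc
  exact ifal_isEpsOptimal_of_smoothedGap_le hP hxs hxs2 hρ hε h₀ hv ν (by linarith)

theorem outerBound_rhoOpt (X ε : ℝ) : outerBound X (rhoOpt X ε) ε = 1 := if_pos le_rfl

/-- For `ρ = 16 ‖x*‖² / ε`, one outer iteration with `max 1 ⌊B⌋` inner iterations (which have
accuracy `2 δ₀`) gives an `ε`-optimal point. -/
theorem ifal_rhoOpt_isEpsOptimal (hP : P.Standing Lf) (hxs : P.IsOptimalMultiplier xs)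
    (hxs2 : 2 ≤ ‖xs‖) (hε : 0 < ε) (h₀ : P.IsInitialPair (rhoOpt ‖xs‖ ε) ε u₀ x₀)
    (hv : ∀ k, v k ∈ P.U) (ν : ℕ → ℕ)
    (hN : max 1 ⌊P.projEstimate Lf ‖xs‖ ε⌋₊ ≤ ν 0) :
    P.IsEpsOptimal ε (P.ifal Lf (rhoOpt ‖xs‖ ε) u₀ x₀ v ν 1).u := by
  have hX : 0 < ‖xs‖ := by linarith
  have hρ := rhoOpt_pos hX hε
  have h := ifal_isEpsOptimal_of_smoothedGap_le hP hxs hxs2 hρ hε h₀ hv ν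
  rw [outerBound_rhoOpt] at h
  refine h (ifal_one_smoothedGap_le hP hρ hε h₀ hv ν ?_)
  -- Here `c = 1`, `a = 2` and `r = D_U`, with equality in `2 r² ≤ a c² D_U²`.
  exact innerSolve_rhoOpt_accurate hP hX hε _ (hv 0) zero_le_one zero_le_two
    (fun u hu => hP.norm_sub_le_diam (hv 0) hu) (by linarith) (by rwa [one_mul])

end EpsOptimality

end LinProblem

/-! ### Assembly of the theorem -/

theorem mainTheorem3 {n m : ℕ} (P : LinProblem n m) (Lf : ℝ) (hP : P.Standing Lf)
    (xs : EuclideanSpace ℝ (Fin m)) (hxs : P.IsOptimalMultiplier xs) (hxs2 : 2 ≤ ‖xs‖) :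
    (∀ ε : ℝ, 0 < ε →
      -- the choice `ρ = 16 ‖x*‖² / ε`: a single outer iteration, and its number of projections
      (∀ u₀ x₀, P.IsInitialPair (rhoOpt ‖xs‖ ε) ε u₀ x₀ →
        ∀ v : ℕ → EuclideanSpace ℝ (Fin n), (∀ k, v k ∈ P.U) → ∀ ν : ℕ → ℕ,
          (P.ifal Lf (rhoOpt ‖xs‖ ε) u₀ x₀ v ν 1).projections = ν 0 ∧
          (max 1 ⌊P.projEstimate Lf ‖xs‖ ε⌋₊ ≤ ν 0 →
            P.IsEpsOptimal ε (P.ifal Lf (rhoOpt ‖xs‖ ε) u₀ x₀ v ν 1).u) ∧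
          (∀ N, max 1 ⌊2 * P.projEstimate Lf ‖xs‖ ε⌋₊ ≤ N →
            P.CallAccurate Lf (rhoOpt ‖xs‖ ε) ε u₀ x₀ v ν 0 N) ∧
          ((∀ u ∈ P.U, ‖v 0 - u‖ ≤ Metric.diam P.U / √2) →
            ∀ N, max 1 ⌊P.projEstimate Lf ‖xs‖ ε⌋₊ ≤ N →
              P.CallAccurate Lf (rhoOpt ‖xs‖ ε) ε u₀ x₀ v ν 0 N) ∧
          (P.CallAccurate Lf (rhoOpt ‖xs‖ ε) ε u₀ x₀ v ν 0 (ν 0) →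
            P.IsEpsOptimal ε (P.ifal Lf (rhoOpt ‖xs‖ ε) u₀ x₀ v ν 1).u) ∧
          (IsLeast {N | P.CallAccurate Lf (rhoOpt ‖xs‖ ε) ε u₀ x₀ v ν 0 N} (ν 0) →
            (P.ifal Lf (rhoOpt ‖xs‖ ε) u₀ x₀ v ν 1).projections
                ≤ max 1 ⌊2 * P.projEstimate Lf ‖xs‖ ε⌋₊ ∧
            ((∀ u ∈ P.U, ‖v 0 - u‖ ≤ Metric.diam P.U / √2) →
              (P.ifal Lf (rhoOpt ‖xs‖ ε) u₀ x₀ v ν 1).projections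
                ≤ max 1 ⌊P.projEstimate Lf ‖xs‖ ε⌋₊))) ∧
      -- the complexity estimate for an arbitrary smoothing parameter
      (∀ ρ : ℝ, 0 < ρ → ∀ u₀ x₀, P.IsInitialPair ρ ε u₀ x₀ →
        ∀ v : ℕ → EuclideanSpace ℝ (Fin n), (∀ k, v k ∈ P.U) → ∀ ν : ℕ → ℕ,
          (∀ k N, P.innerBound Lf ρ ε k ≤ N → P.CallAccurate Lf ρ ε u₀ x₀ v ν k N) ∧
          ((∀ k < outerBound ‖xs‖ ρ ε, P.CallAccurate Lf ρ ε u₀ x₀ v ν k (ν k)) →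
            P.IsEpsOptimal ε (P.ifal Lf ρ u₀ x₀ v ν (outerBound ‖xs‖ ρ ε)).u) ∧
          ((∀ k < outerBound ‖xs‖ ρ ε,
              IsLeast {N | P.CallAccurate Lf ρ ε u₀ x₀ v ν k N} (ν k)) →
            (P.ifal Lf ρ u₀ x₀ v ν (outerBound ‖xs‖ ρ ε)).projections
              ≤ P.totalBound Lf ‖xs‖ ρ ε)) ∧
      -- `ρ = 16 ‖x*‖² / ε` minimizes that estimate up to an absolute constant factor
      (∀ ρ : ℝ, 0 < ρ →
        P.totalBound Lf ‖xs‖ (rhoOpt ‖xs‖ ε) ε ≤ 2 * P.totalBound Lf ‖xs‖ ρ ε)) ∧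
    -- starting points within `D_U / √2` of all of `U` exist
    (∃ c ∈ P.U, ∀ u ∈ P.U, ‖c - u‖ ≤ Metric.diam P.U / √2) ∧
    -- the number of projections is of order `1 / ε`
    ((fun ε : ℝ => ((max 1 ⌊2 * P.projEstimate Lf ‖xs‖ ε⌋₊ : ℕ) : ℝ))
      =O[nhdsWithin 0 (Set.Ioi 0)] fun ε : ℝ => 1 / ε) := by
  have hX : 0 < ‖xs‖ := by linarith
  refine ⟨fun ε hε => ⟨?_, ?_, fun ρ hρ => LinProblem.totalBound_rhoOpt_le hP hX hρ hε⟩,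
    hP.isCompact_U.exists_norm_sub_le_diam_div_sqrt_two hP.convex_U hP.nonempty_U,
    LinProblem.projEstimate_isBigO P Lf hX.le⟩
  · intro u₀ x₀ h₀ v hv ν
    have hproj : (P.ifal Lf (rhoOpt ‖xs‖ ε) u₀ x₀ v ν 1).projections = ν 0 := by
      simp [LinProblem.ifal_projections]
    have hacc : ∀ N, max 1 ⌊2 * P.projEstimate Lf ‖xs‖ ε⌋₊ ≤ N →
        P.CallAccurate Lf (rhoOpt ‖xs‖ ε) ε u₀ x₀ v ν 0 N := fun N hN => by
      have hD := sq_nonneg (Metric.diam P.U)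
      -- Here `c = 2` and `a = 1`; the factor `c = √2` would already satisfy `2 r² ≤ a c² D_U²` with
      -- `r = D_U`.
      have h := LinProblem.innerSolve_rhoOpt_accurate hP hX hε
        (P.xhat 0 (P.ifal Lf (rhoOpt ‖xs‖ ε) u₀ x₀ v ν 0)) (hv 0) zero_le_two zero_le_one
        (fun u hu => hP.norm_sub_le_diam (hv 0) hu) (by linarith) hN
      rwa [one_mul] at h
    have hacc' : (∀ u ∈ P.U, ‖v 0 - u‖ ≤ Metric.diam P.U / √2) →
        ∀ N, max 1 ⌊P.projEstimate Lf ‖xs‖ ε⌋₊ ≤ N →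
          P.CallAccurate Lf (rhoOpt ‖xs‖ ε) ε u₀ x₀ v ν 0 N := fun hr N hN => by
      have h := LinProblem.innerSolve_rhoOpt_accurate (N := N) hP hX hε
        (P.xhat 0 (P.ifal Lf (rhoOpt ‖xs‖ ε) u₀ x₀ v ν 0)) (hv 0) zero_le_one zero_le_one hr
        (by rw [div_pow, Real.sq_sqrt zero_le_two]; linarith) (by rwa [one_mul])
      rwa [one_mul] at h
    refine ⟨hproj, LinProblem.ifal_rhoOpt_isEpsOptimal hP hxs hxs2 hε h₀ hv ν, hacc, hacc',
      fun h => ?_, fun h => ?_⟩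
    · have h1 := LinProblem.ifal_outerBound_isEpsOptimal hP hxs hxs2 (LinProblem.rhoOpt_pos hX hε) hε h₀ hv ν
      rw [LinProblem.outerBound_rhoOpt] at h1
      exact h1 fun k hk => by rwa [Nat.lt_one_iff.1 hk]
    · rw [hproj]
      exact ⟨h.2 (hacc _ le_rfl), fun hr => h.2 (hacc' hr _ le_rfl)⟩
  · intro ρ hρ u₀ x₀ h₀ v hv ν
    have hacc : ∀ k N, P.innerBound Lf ρ ε k ≤ N → P.CallAccurate Lf ρ ε u₀ x₀ v ν k N :=
      fun k N hN => LinProblem.innerSolve_accurate_of_innerBound_le hP hρ hε _ (hv k) hN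
    refine ⟨hacc, LinProblem.ifal_outerBound_isEpsOptimal hP hxs hxs2 hρ hε h₀ hv ν,
      fun h => ?_⟩
    rw [LinProblem.ifal_projections]
    -- The state before call `k` depends only on `ν j` with `j < k`, so describing `ν k` as the
    -- least accurate count is not circular; leastness bounds it by `innerBound`.
    exact Finset.sum_le_sum fun k hk => (h k (Finset.mem_range.1 hk)).2 (hacc k _ le_rfl)
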